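/- For each positive integer $n$ let $\mathbf d=\mathbf d(n)=(d_1,\dots,d_n)$ be a sequence of non-negative integers with $d_1\ge d_2\ge\dots\ge d_n$ and $\|\mathbf d\|_1=\sum_{i=1}^n d_i$ even. Put $\delta(\mathbf d)=d_n$ and $J(\mathbf d)=\sum_{i=1}^{d_1}d_i$ (with $d_i=0$ for $i>n$), and let $P=P(\mathbf d)$ be the symmetric $n\times n$ matrix with $P_{jk}=\dfrac{d_jd_k}{\|\mathbf d\|_1+d_jd_k}$ for $j\ne k$ and $P_{jj}=0$. Let $\mathcal G(n,\mathbf d)$ denote a uniformly random simple graph on $[n]=\{1,\dots,n\}$ in which every vertex $i$ has degree $d_i$ and, for a symmetric $n\times n$ matrix $W$ with entries in $[0,1]$, let $\mathcal G(n,W)$ denote the random graph on $[n]$ in which each edge $jk$, $j<k$, is present independently with probability $W_{jk}$. Assume that, as $n\to\infty$, $J(\mathbf d)=o(\|\mathbf d\|_1)$ and $\log n=o(\delta(\mathbf d))$. Then there are symmetric matrices $W=W(n)\in[0,1]^{n\times n}$ with $$W_{jk}=(1+o(1))\bigl(1-e^{-P_{jk}}\bigr)\qquad\text{uniformly in } j,k\in[n],$$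 such that, for all sufficiently large $n$, a graph with degree sequence $\mathbf d$ exists and there is a coupling $(G_L,G)$ (a pair of random graphs on one probability space) with $G_L\sim\mathcal G(n,W)$ and $G\sim\mathcal G(n,\mathbf d)$, and such that $\mathbb P(G_L\subseteq G)\to1$ as $n\to\infty$. -/

import Mathlib

open Filter Topology MeasureTheory ProbabilityTheory Asymptotics

noncomputable section

namespace DegSeq

/-- The `ℓ¹`-norm `‖d‖₁ = ∑ i, d i`. -/
def norm1 {n : ℕ} (d : Fin n → ℕ) : ℕ := ∑ i, d i

/-- The maximum entry `Δ(d)`; it equals the first entry when `d` is non-increasing. -/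
def maxDeg {n : ℕ} (d : Fin n → ℕ) : ℕ := Finset.univ.sup d

/-- The minimum entry `δ(d)`; it equals the last entry when `d` is non-increasing. -/
def minDeg {n : ℕ} (d : Fin n → ℕ) : ℕ := ⨅ i, d i

/-- `J(d) = d₁ + d₂ + ⋯ + d_Δ` with `Δ = d₁`, for a non-increasing sequence `d`
(the index `i : Fin n` stands for the entry number `i + 1`). -/
def J {n : ℕ} (d : Fin n → ℕ) : ℕ := ∑ i : Fin n, if i.val < maxDeg d then d i else 0

/-- The matrix `P(d)`, with entries `d_j d_k / (‖d‖₁ + d_j d_k)` off the diagonal and `0` on it. -/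
def P {n : ℕ} (d : Fin n → ℕ) : Matrix (Fin n) (Fin n) ℝ :=
  Matrix.of fun j k =>
    if j = k then 0 else ((d j : ℝ) * d k) / ((norm1 d : ℝ) + (d j : ℝ) * d k)

/-- The graphs on `Fin n` in which every vertex `i` has degree `d i`. -/
def realizations {n : ℕ} (d : Fin n → ℕ) : Set (SimpleGraph (Fin n)) :=
  {G | ∀ i, (G.neighborSet i).ncard = d i}

/-- The law of `𝒢(n, d)`: the uniform probability measure on the graphs with degree sequence `d`
(it is the zero measure, hence not a probability measure, if there is no such graph). -/
def degreeModel {n : ℕ} (d : Fin n → ℕ) : Measure (SimpleGraph (Fin n)) :=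
  uniformOn (realizations d)

/-- The pairs `j < k`, standing for the edges `jk` of the complete graph. -/
abbrev Pairs (n : ℕ) : Type := {e : Fin n × Fin n // e.1 < e.2}

/-- The graph whose edges are the pairs `jk`, `j < k`, with `ω jk` true. -/
def graphOfPairs {n : ℕ} (ω : Pairs n → Prop) : SimpleGraph (Fin n) :=
  SimpleGraph.fromRel fun j k => ∃ h : j < k, ω ⟨(j, k), h⟩

/-- The law of `𝒢(n, W)`: every edge `jk`, `j < k`, is present with probability `W j k`,
independently of the others. -/
def edgeModel {n : ℕ} (W : Matrix (Fin n) (Fin n) unitInterval) :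
    Measure (SimpleGraph (Fin n)) :=
  (Measure.pi fun e : Pairs n => bernoulliMeasure True False (W e.1.1 e.1.2)).map graphOfPairs

/-- `γ` is (the joint law of) a coupling of the laws `μ` and `ν`. -/
structure IsCoupling {α β : Type*} [MeasurableSpace α] [MeasurableSpace β]
    (γ : Measure (α × β)) (μ : Measure α) (ν : Measure β) : Prop where
  isProbabilityMeasure : IsProbabilityMeasure γ
  fst_eq : γ.fst = μ
  snd_eq : γ.snd = ν

/-- `A = (1 + o(1)) B` for sequences of matrices, uniformly over the entries. -/
def UniformlyAsymptotic (A B : ∀ n : ℕ, Matrix (Fin n) (Fin n) ℝ) : Prop :=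
  ∀ ε : ℝ, 0 < ε → ∀ᶠ n in atTop, ∀ j k, |A n j k - B n j k| ≤ ε * |B n j k|

end DegSeq

end

/-!
Expose the edges of a uniform graph `G` with degree sequence `d` one by one in uniformly random
order. Given the set `H` of edges exposed so far, the next edge `e` has some probability
`nextEdge H e`. On the other side, draw independent pairs of vertices from a fixed law `q` that is
proportional to `P d`. As long as `q ≤ nextEdge H` off `H`, every drawn pair can be coupled to be
the next exposed edge of `G` or an edge exposed earlier, so that the drawn pairs form a subgraph
of `G`. With a Poisson number of draws the events that different pairs are drawn at all are
independent, and `e` is drawn with probability `1 - exp (-λ q e)`; this is the random graph with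
independent edges.

The inequality `q ≤ nextEdge H` is proved by switchings: a pair `j k` outside `H` is inserted, edges
`j a` and `k b` that are still hidden are removed, and `a`, `b` are reattached along a third edge
`x y`. This gives the right count unless some vertex has only a small fraction of its edges still
hidden. Since hidden edges at a vertex disappear no faster than hypergeometrically, an exponential
potential that is a supermartingale under the exposure bounds the probability that this ever
happens, by a union bound over the vertices; `log n = o(minDeg d)` makes the bound tend to zero.
The losses are governed by a factor `κ < 1`, which is sent to `1` slowly at the end.
-/


noncomputable section

namespace DegSeq

section Domination

variable {α β ι : Type*}

/-- The law of a pair of independent variables with laws `μ` and `ν`. -/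
def indepPMF (μ : PMF α) (ν : PMF β) : PMF (α × β) := μ.bind fun a => ν.map (Prod.mk a)

theorem indepPMF_map_fst (μ : PMF α) (ν : PMF β) : (indepPMF μ ν).map Prod.fst = μ := by
  simp only [indepPMF, PMF.map_bind, PMF.map_comp]
  exact (congrArg μ.bind (funext fun a => ν.map_const a)).trans μ.bind_pure

theorem indepPMF_map_snd (μ : PMF α) (ν : PMF β) : (indepPMF μ ν).map Prod.snd = ν := by
  simp only [indepPMF, PMF.map_bind, PMF.map_comp]
  exact (congrArg μ.bind (funext fun _ => ν.map_id)).trans (μ.bind_const ν)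

theorem mem_support_indepPMF {μ : PMF α} {ν : PMF β} {x : α × β} :
    x ∈ (indepPMF μ ν).support ↔ x.1 ∈ μ.support ∧ x.2 ∈ ν.support := by
  obtain ⟨a, b⟩ := x
  simp only [indepPMF, PMF.mem_support_bind_iff, PMF.mem_support_map_iff, Prod.mk.injEq]
  grind

theorem toOuterMeasure_le_one (μ : PMF α) (s : Set α) : μ.toOuterMeasure s ≤ 1 := by
  rw [PMF.toOuterMeasure_apply, ← μ.tsum_coe]
  exact ENNReal.tsum_le_tsum fun a => Set.indicator_le_self _ _ _

/-- Approximate stochastic domination: `μ` and `ν` have a coupling under which the first variable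
is below the second one outside an event of probability at most `b`. -/
def DominatedUpTo [LE α] (b : ENNReal) (μ ν : PMF α) : Prop :=
  ∃ γ : PMF (α × α), γ.map Prod.fst = μ ∧ γ.map Prod.snd = ν ∧
    γ.toOuterMeasure {x | ¬ x.1 ≤ x.2} ≤ b

theorem dominatedUpTo_of_one_le [LE α] {b : ENNReal} (hb : 1 ≤ b) (μ ν : PMF α) :
    DominatedUpTo b μ ν :=
  ⟨indepPMF μ ν, indepPMF_map_fst μ ν, indepPMF_map_snd μ ν, (toOuterMeasure_le_one _ _).trans hb⟩

theorem dominatedUpTo_zero_of_support_le [LE α] {μ ν : PMF α}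
    (h : ∀ a ∈ μ.support, ∀ b ∈ ν.support, a ≤ b) : DominatedUpTo 0 μ ν := by
  refine ⟨indepPMF μ ν, indepPMF_map_fst μ ν, indepPMF_map_snd μ ν, ?_⟩
  rw [nonpos_iff_eq_zero, PMF.toOuterMeasure_apply_eq_zero_iff, Set.disjoint_left]
  intro x hx
  rw [mem_support_indepPMF] at hx
  exact not_not_intro (h x.1 hx.1 x.2 hx.2)

namespace DominatedUpTo

variable {b c : ENNReal} {μ ν : PMF α}

theorem mono [LE α] (h : DominatedUpTo b μ ν) (hbc : b ≤ c) : DominatedUpTo c μ ν :=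
  let ⟨γ, hfst, hsnd, hγ⟩ := h
  ⟨γ, hfst, hsnd, hγ.trans hbc⟩

theorem map [Preorder α] [Preorder β] {f : α → β} (hf : Monotone f) (h : DominatedUpTo b μ ν) :
    DominatedUpTo b (μ.map f) (ν.map f) := by
  obtain ⟨γ, rfl, rfl, hγ⟩ := h
  refine ⟨γ.map (Prod.map f f), by simp only [PMF.map_comp]; rfl,
    by simp only [PMF.map_comp]; rfl, ?_⟩
  rw [PMF.toOuterMeasure_map_apply]
  have hsub : Prod.map f f ⁻¹' {x | ¬ x.1 ≤ x.2} ⊆ {x | ¬ x.1 ≤ x.2} :=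
    fun _ hx hle => hx (hf hle)
  exact (γ.toOuterMeasure.mono hsub).trans hγ

theorem bind [LE α] (σ : PMF ι) {b : ι → ENNReal} {μ ν : ι → PMF α}
    (h : ∀ i ∈ σ.support, DominatedUpTo (b i) (μ i) (ν i)) :
    DominatedUpTo (∑' i, σ i * b i) (σ.bind μ) (σ.bind ν) := by
  have total (i : ι) : ∃ γ : PMF (α × α), γ.map Prod.fst = μ i ∧ γ.map Prod.snd = ν i ∧
      (i ∈ σ.support → γ.toOuterMeasure {x | ¬ x.1 ≤ x.2} ≤ b i) := by
    by_cases hi : i ∈ σ.support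
    · obtain ⟨γ, hfst, hsnd, hγ⟩ := h i hi
      exact ⟨γ, hfst, hsnd, fun _ => hγ⟩
    · exact ⟨_, indepPMF_map_fst _ _, indepPMF_map_snd _ _, fun hi' => absurd hi' hi⟩
  choose γ hfst hsnd hγ using total
  refine ⟨σ.bind γ, by simp only [PMF.map_bind, hfst], by simp only [PMF.map_bind, hsnd], ?_⟩
  rw [PMF.toOuterMeasure_bind_apply]
  refine ENNReal.tsum_le_tsum fun i => ?_
  by_cases hi : i ∈ σ.support
  · gcongr
    exact hγ i hi
  · simp [(σ.apply_eq_zero_iff i).2 hi]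

theorem bind_of_mem [LE α] {σ : PMF ι} {s : Set ι} {μ : ι → PMF α}
    (h : ∀ i ∈ s, DominatedUpTo b (μ i) ν) :
    DominatedUpTo (b + σ.toOuterMeasure sᶜ) (σ.bind μ) ν := by
  classical
  rw [← PMF.bind_const σ ν]
  refine (bind σ (b := fun i => if i ∈ s then b else 1) fun i _ => ?_).mono ?_
  · split_ifs with hi
    · exact h i hi
    · exact dominatedUpTo_of_one_le le_rfl _ _
  · calc ∑' i, σ i * (if i ∈ s then b else 1)
        ≤ ∑' i, (σ i * b + sᶜ.indicator σ i) := by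
          refine ENNReal.tsum_le_tsum fun i => ?_
          by_cases hi : i ∈ s <;> simp [hi]
      _ = b + σ.toOuterMeasure sᶜ := by
          rw [ENNReal.tsum_add, ENNReal.tsum_mul_right, PMF.tsum_coe, one_mul,
            PMF.toOuterMeasure_apply]

theorem exists_isCoupling [LE α] [MeasurableSpace α] [Countable α] [MeasurableSingletonClass α]
    (h : DominatedUpTo b μ ν) :
    ∃ γ : Measure (α × α), IsCoupling γ μ.toMeasure ν.toMeasure ∧ 1 - b ≤ γ {p | p.1 ≤ p.2} := by
  obtain ⟨γ, rfl, rfl, hγ⟩ := h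
  refine ⟨γ.toMeasure, ⟨inferInstance, PMF.toMeasure_map _ _ measurable_fst,
    PMF.toMeasure_map _ _ measurable_snd⟩, ?_⟩
  have hcompl : γ.toMeasure {p | p.1 ≤ p.2}ᶜ ≤ b := by
    rw [PMF.toMeasure_apply_eq_toOuterMeasure]
    exact hγ
  rw [tsub_le_iff_right, ← prob_add_prob_compl (μ := γ.toMeasure) (s := {p : α × α | p.1 ≤ p.2})
    (Set.to_countable _).measurableSet]
  gcongr

end DominatedUpTo

end Domination

section MaximalCoupling

variable {α β : Type*}

theorem tsum_map_mul (p : PMF α) (f : α → β) (g : β → ENNReal) :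
    ∑' b, p.map f b * g b = ∑' a, p a * g (f a) := by
  classical
  simp only [PMF.map_apply, ← ENNReal.tsum_mul_right]
  rw [ENNReal.tsum_comm]
  refine tsum_congr fun a => (tsum_eq_single (f a) fun b hb => ?_).trans ?_
  · rw [if_neg hb, zero_mul]
  · rw [if_pos rfl]

theorem exists_residual (μ ν : PMF α) (H : Set α) (h : ∀ a ∉ H, μ a ≤ ν a) :
    ∃ ρ : PMF α, ∀ a, μ.toOuterMeasure H * ρ a + Hᶜ.indicator μ a = ν a := by
  classical
  set f : α → ENNReal := fun a => ν a - Hᶜ.indicator μ a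
  have hle (a : α) : Hᶜ.indicator μ a ≤ ν a := by
    by_cases ha : a ∈ H
    · simp [ha]
    · simpa [ha] using h a ha
  have hfν (a : α) : f a + Hᶜ.indicator μ a = ν a := tsub_add_cancel_of_le (hle a)
  have hcfin : ∑' a, Hᶜ.indicator μ a ≠ ⊤ :=
    ((ENNReal.tsum_le_tsum hle).trans_eq ν.tsum_coe).trans_lt ENNReal.one_lt_top |>.ne
  have hf : ∑' a, f a = μ.toOuterMeasure H := by
    refine (ENNReal.add_left_inj hcfin).1 ?_
    rw [← ENNReal.tsum_add, PMF.toOuterMeasure_apply, ← ENNReal.tsum_add, tsum_congr hfν,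
      ν.tsum_coe, ← μ.tsum_coe]
    exact tsum_congr fun a => (congrFun (Set.indicator_self_add_compl H μ) a).symm
  by_cases h0 : μ.toOuterMeasure H = 0
  · refine ⟨ν, fun a => ?_⟩
    have hfa : f a = 0 := ENNReal.tsum_eq_zero.1 (hf.trans h0) a
    rw [h0, zero_mul, ← hfν a, hfa]
  · have hfin : μ.toOuterMeasure H ≠ ⊤ :=
      ((toOuterMeasure_le_one μ H).trans_lt ENNReal.one_lt_top).ne
    refine ⟨PMF.normalize f (hf ▸ h0) (hf ▸ hfin), fun a => ?_⟩
    rw [PMF.normalize_apply, hf, mul_left_comm, ENNReal.mul_inv_cancel h0 hfin, mul_one, hfν]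

/-- The first variable is kept as the second one outside `H`, and replaced by an independent sample
of the residual law in `H`. -/
theorem exists_coupling_eq_off (μ ν : PMF α) (H : Set α) (h : ∀ a ∉ H, μ a ≤ ν a) :
    ∃ σ : PMF (α × α), σ.map Prod.fst = μ ∧ σ.map Prod.snd = ν ∧
      ∀ x ∈ σ.support, x.1 ∈ H ∨ x.1 = x.2 := by
  classical
  obtain ⟨ρ, hρ⟩ := exists_residual μ ν H h
  refine ⟨μ.bind fun a => (if a ∈ H then ρ else PMF.pure a).map (Prod.mk a), ?_, ?_, ?_⟩
  · simp only [PMF.map_bind, PMF.map_comp]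
    exact (congrArg μ.bind (funext fun a => PMF.map_const _ a)).trans μ.bind_pure
  · simp only [PMF.map_bind, PMF.map_comp]
    refine (congrArg μ.bind (funext fun a => PMF.map_id _)).trans (PMF.ext fun b => ?_)
    rw [PMF.bind_apply, ← hρ b, PMF.toOuterMeasure_apply, ← ENNReal.tsum_mul_right,
      ← tsum_ite_eq b (fun _ => Hᶜ.indicator μ b), ← ENNReal.tsum_add]
    refine tsum_congr fun a => ?_
    by_cases ha : a ∈ H <;> by_cases hab : a = b
    · subst hab; simp [ha]
    · simp [ha, hab]
    · subst hab; simp [ha]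
    · simp [ha, hab, Ne.symm hab]
  · intro x hx
    simp only [PMF.mem_support_bind_iff, PMF.mem_support_map_iff] at hx
    obtain ⟨a, -, b, hb, rfl⟩ := hx
    by_cases ha : a ∈ H
    · exact Or.inl ha
    · rw [if_neg ha, PMF.mem_support_pure_iff] at hb
      exact Or.inr hb.symm

end MaximalCoupling

section EdgeExposure

variable {E : Type*} [DecidableEq E]

/-- The members of the family `R` that contain `H`. -/
def above (R : Finset (Finset E)) (H : Finset E) : Finset (Finset E) := R.filter (H ⊆ ·)

theorem mem_above {R : Finset (Finset E)} {H G : Finset E} :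
    G ∈ above R H ↔ G ∈ R ∧ H ⊆ G := Finset.mem_filter

/-- The uniform law on `s`, made total by a point mass if `s` is empty. -/
def unifPMF {α : Type*} [Inhabited α] (s : Finset α) : PMF α :=
  open Classical in if h : s.Nonempty then PMF.uniformOfFinset s h else PMF.pure default

theorem unifPMF_of_nonempty {α : Type*} [Inhabited α] {s : Finset α} (h : s.Nonempty) :
    unifPMF s = PMF.uniformOfFinset s h := dif_pos h

theorem unifPMF_apply {α : Type*} [Inhabited α] [DecidableEq α] {s : Finset α} (h : s.Nonempty)
    (a : α) : unifPMF s a = if a ∈ s then (((s.card : NNReal)⁻¹ : NNReal) : ENNReal) else 0 := by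
  have hcard : (s.card : NNReal) ≠ 0 := Nat.cast_ne_zero.2 h.card_pos.ne'
  rw [unifPMF_of_nonempty h, PMF.uniformOfFinset_apply, ENNReal.coe_inv hcard,
    ENNReal.coe_natCast]
  congr

/-- The probability that `f` is the next edge exposed, when the edges of a uniformly random member
of `R` (all of whose members have `m` edges) are exposed in random order and those in `H` have been
exposed so far. -/
def nextEdge (R : Finset (Finset E)) (m : ℕ) (H : Finset E) (f : E) : NNReal :=
  if f ∈ H then 0
  else (above R (insert f H)).card / ((above R H).card * (m - H.card : ℕ))

/-- The set obtained from `S` by adding a sample, which may be void. -/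
def addSample (o : Option E) (S : Finset E) : Finset E := o.elim S fun f => insert f S

theorem subset_addSample (o : Option E) (S : Finset E) : S ⊆ addSample o S := by
  cases o with
  | none => exact subset_rfl
  | some f => exact Finset.subset_insert f S

/-- The set obtained from `S` by adding `r` independent samples from `Q`. -/
def sampleSet (Q : PMF (Option E)) : ℕ → Finset E → PMF (Finset E)
  | 0, S => PMF.pure S
  | r + 1, S => Q.bind fun o => sampleSet Q r (addSample o S)

variable {R : Finset (Finset E)} {m : ℕ} {H : Finset E}

theorem card_sdiff_of_mem_above (hR : ∀ G ∈ R, G.card = m) {G : Finset E} (hG : G ∈ above R H) :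
    (G \ H).card = m - H.card := by
  rw [Finset.card_sdiff_of_subset (mem_above.1 hG).2, hR G (mem_above.1 hG).1]

theorem above_insert_nonempty {f : E} (hf : nextEdge R m H f ≠ 0) :
    f ∉ H ∧ (above R (insert f H)).Nonempty := by
  unfold nextEdge at hf
  split_ifs at hf with h
  · exact absurd rfl hf
  · refine ⟨h, Finset.nonempty_iff_ne_empty.2 fun hempty => hf ?_⟩
    rw [hempty, Finset.card_empty, Nat.cast_zero, zero_div]

theorem nextEdge_mul_unifPMF (f : E) (G : Finset E) :
    (nextEdge R m H f : ENNReal) * unifPMF (above R (insert f H)) G =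
      if G ∈ above R H ∧ f ∈ G \ H then
        ((((above R H).card * (m - H.card : ℕ) : NNReal)⁻¹ : NNReal) : ENNReal) else 0 := by
  have hiff : G ∈ above R H ∧ f ∈ G \ H ↔ f ∉ H ∧ G ∈ above R (insert f H) := by
    simp only [mem_above, Finset.insert_subset_iff, Finset.mem_sdiff]
    tauto
  by_cases hG : f ∉ H ∧ G ∈ above R (insert f H)
  · have hne : (above R (insert f H)).Nonempty := ⟨G, hG.2⟩
    have hcard : ((above R (insert f H)).card : NNReal) ≠ 0 := Nat.cast_ne_zero.2 hne.card_pos.ne'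
    rw [if_pos (hiff.2 hG), nextEdge, if_neg hG.1, unifPMF_apply hne, if_pos hG.2,
      ← ENNReal.coe_mul, div_mul_eq_mul_div, mul_inv_cancel₀ hcard, one_div]
  · rw [if_neg (mt hiff.1 hG)]
    by_cases h0 : nextEdge R m H f = 0
    · simp [h0]
    · obtain ⟨hf, hne⟩ := above_insert_nonempty h0
      rw [unifPMF_apply hne, if_neg fun hmem => hG ⟨hf, hmem⟩, mul_zero]

variable [Fintype E]

theorem sum_nextEdge_mul_unifPMF (hR : ∀ G ∈ R, G.card = m) (hH : (above R H).Nonempty)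
    (hm : H.card < m) (G : Finset E) :
    ∑ f, (nextEdge R m H f : ENNReal) * unifPMF (above R (insert f H)) G =
      unifPMF (above R H) G := by
  simp only [nextEdge_mul_unifPMF, unifPMF_apply hH]
  by_cases hG : G ∈ above R H
  · have hm' : ((m - H.card : ℕ) : NNReal) ≠ 0 := Nat.cast_ne_zero.2 (Nat.sub_ne_zero_of_lt hm)
    simp only [hG, true_and, if_true]
    rw [Finset.sum_ite_mem, Finset.univ_inter, Finset.sum_const,
      card_sdiff_of_mem_above hR hG, nsmul_eq_mul, ← ENNReal.coe_natCast, ← ENNReal.coe_mul,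
      mul_inv, mul_left_comm, mul_inv_cancel₀ hm', mul_one]
  · simp [hG]

theorem sum_nextEdge (hR : ∀ G ∈ R, G.card = m) (hH : (above R H).Nonempty) (hm : H.card < m) :
    ∑ f, (nextEdge R m H f : ENNReal) = 1 :=
  calc ∑ f, (nextEdge R m H f : ENNReal)
      = ∑ f, ∑ G, (nextEdge R m H f : ENNReal) * unifPMF (above R (insert f H)) G := by
        refine Finset.sum_congr rfl fun f _ => ?_
        rw [← Finset.mul_sum, ← tsum_fintype (L := .unconditional _), PMF.tsum_coe, mul_one]
    _ = ∑ G, unifPMF (above R H) G := by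
        rw [Finset.sum_comm]
        exact Finset.sum_congr rfl fun G _ => sum_nextEdge_mul_unifPMF hR hH hm G
    _ = 1 := by rw [← tsum_fintype (L := .unconditional _), PMF.tsum_coe]

/-- The law of the next exposed edge. -/
def nextPMF (hR : ∀ G ∈ R, G.card = m) (hH : (above R H).Nonempty) (hm : H.card < m) : PMF E :=
  PMF.ofFintype (fun f => nextEdge R m H f) (sum_nextEdge hR hH hm)

theorem nextPMF_apply (hR : ∀ G ∈ R, G.card = m) (hH : (above R H).Nonempty) (hm : H.card < m)
    (f : E) : nextPMF hR hH hm f = nextEdge R m H f := rfl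

theorem nextPMF_bind_unifPMF (hR : ∀ G ∈ R, G.card = m) (hH : (above R H).Nonempty)
    (hm : H.card < m) :
    ((nextPMF hR hH hm).bind fun f => unifPMF (above R (insert f H))) = unifPMF (above R H) := by
  ext G
  rw [PMF.bind_apply, tsum_fintype]
  exact sum_nextEdge_mul_unifPMF hR hH hm G

/-- Double counting of the pairs `(G, f)` with `f ∈ G \ H`. -/
theorem sum_nextEdge_mul (φ : E → ℝ) :
    ∑ f, nextEdge R m H f * φ f =
      (∑ G ∈ above R H, ∑ f ∈ G \ H, φ f) / ((above R H).card * (m - H.card : ℕ)) := by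
  have hswap : ∑ G ∈ above R H, ∑ f ∈ G \ H, φ f =
      ∑ f ∈ Hᶜ, ∑ _G ∈ above R (insert f H), φ f := by
    refine Finset.sum_comm' fun G f => ?_
    simp only [mem_above, Finset.insert_subset_iff, Finset.mem_sdiff, Finset.mem_compl]
    tauto
  rw [hswap, Finset.sum_div, ← Finset.sum_subset (Finset.subset_univ Hᶜ)]
  · refine Finset.sum_congr rfl fun f hf => ?_
    rw [nextEdge, if_neg (Finset.mem_compl.1 hf), Finset.sum_const, nsmul_eq_mul]
    simp only [NNReal.coe_div, NNReal.coe_mul, NNReal.coe_natCast]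
    ring
  · intro f _ hf
    simp [nextEdge, Finset.mem_compl.not_left.1 hf]

theorem exists_sample_coupling {Q : PMF (Option E)} (hR : ∀ G ∈ R, G.card = m)
    (hH : (above R H).Nonempty) (hm : H.card < m)
    (hQ : ∀ f ∉ H, Q (some f) ≤ nextEdge R m H f) :
    ∃ σ : PMF (Option E × Option E), σ.map Prod.fst = Q ∧
      σ.map Prod.snd = (nextPMF hR hH hm).map some ∧
      ∀ x ∈ σ.support, (∀ S ⊆ H, addSample x.1 S ⊆ addSample x.2 H) ∧
        ∃ f, x.2 = some f ∧ nextEdge R m H f ≠ 0 := by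
  obtain ⟨σ, hfst, hsnd, hσ⟩ := exists_coupling_eq_off Q ((nextPMF hR hH hm).map some)
    {o | ∀ f ∈ o, f ∈ H} fun o ho => by
      obtain ⟨f, rfl, hf⟩ : ∃ f, o = some f ∧ f ∉ H := by simpa using ho
      refine (hQ f hf).trans_eq ?_
      simp [PMF.map_apply, tsum_fintype, nextPMF_apply]
  refine ⟨σ, hfst, hsnd, fun x hx => ⟨fun S hS => ?_, ?_⟩⟩
  · rcases hσ x hx with hH' | heq
    · refine Finset.Subset.trans ?_ (subset_addSample x.2 H)
      rcases h : x.1 with _ | f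
      · exact hS
      · exact Finset.insert_subset (hH' f h) hS
    · rw [heq]
      rcases x.2 with _ | f
      · exact hS
      · exact Finset.insert_subset_insert f hS
  · have hx2 : x.2 ∈ ((nextPMF hR hH hm).map some).support :=
      hsnd ▸ (PMF.mem_support_map_iff _ _ _).2 ⟨x, hx, rfl⟩
    obtain ⟨f, hf, hfx⟩ := (PMF.mem_support_map_iff _ _ _).1 hx2
    exact ⟨f, hfx.symm, by simpa [PMF.mem_support_iff, nextPMF_apply] using hf⟩

/-- As long as `B < 1`, each sample is coupled with the next exposed edge, so that it only yields
edges exposed so far; `B` bounds the probability that this is ever prevented. -/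
theorem dominatedUpTo_sampleSet_unifPMF {Q : PMF (Option E)} (hR : ∀ G ∈ R, G.card = m)
    {T : ℕ} (hT : T ≤ m) {B : Finset E → ENNReal}
    (hB : ∀ H, (above R H).Nonempty → H.card < T → 1 ≤ B H ∨
      (∀ f ∉ H, Q (some f) ≤ nextEdge R m H f) ∧
        ∑ f, (nextEdge R m H f : ENNReal) * B (insert f H) ≤ B H)
    {N : ℕ} {S : Finset E} (hH : (above R H).Nonempty) (hN : H.card + N ≤ T) (hS : S ⊆ H) :
    DominatedUpTo (B H) (sampleSet Q N S) (unifPMF (above R H)) := by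
  induction N generalizing H S with
  | zero =>
    refine (dominatedUpTo_zero_of_support_le fun A hA G hG => ?_).mono zero_le
    rw [sampleSet, PMF.mem_support_pure_iff] at hA
    rw [unifPMF_of_nonempty hH, PMF.mem_support_uniformOfFinset_iff] at hG
    exact hA ▸ hS.trans (mem_above.1 hG).2
  | succ N ih =>
    rcases hB H hH (by omega) with hbad | ⟨hQ, hstep⟩
    · exact dominatedUpTo_of_one_le hbad _ _
    have hm : H.card < m := by omega
    obtain ⟨σ, hfst, hsnd, hσ⟩ := exists_sample_coupling hR hH hm hQ
    have hbind := DominatedUpTo.bind σ (b := fun x => B (addSample x.2 H))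
      (μ := fun x => sampleSet Q N (addSample x.1 S))
      (ν := fun x => unifPMF (above R (addSample x.2 H))) fun x hx => by
        obtain ⟨hsub, f, hf, hne⟩ := hσ x hx
        rw [hf] at hsub ⊢
        obtain ⟨hfH, hne'⟩ := above_insert_nonempty hne
        refine ih hne' ?_ (hsub S hS)
        have hcard : (addSample (some f) H).card = H.card + 1 := Finset.card_insert_of_notMem hfH
        omega
    have hμ : (σ.bind fun x => sampleSet Q N (addSample x.1 S)) = sampleSet Q (N + 1) S := by
      rw [sampleSet, ← hfst, PMF.bind_map]
      rfl
    have hν : (σ.bind fun x => unifPMF (above R (addSample x.2 H))) = unifPMF (above R H) := by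
      rw [← nextPMF_bind_unifPMF hR hH hm]
      trans (σ.map Prod.snd).bind fun o => unifPMF (above R (addSample o H))
      · rw [PMF.bind_map]; rfl
      · rw [hsnd, PMF.bind_map]; rfl
    rw [hμ, hν] at hbind
    refine hbind.mono ?_
    rw [← tsum_map_mul σ Prod.snd fun o => B (addSample o H), hsnd, tsum_map_mul, tsum_fintype]
    exact hstep

end EdgeExposure

section Poisson

/-- The Poisson distribution as a probability mass function. -/
def poisPMF (r : NNReal) : PMF ℕ := (poissonMeasure r).toPMF

theorem poisPMF_apply (r : NNReal) (k : ℕ) :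
    poisPMF r k = ENNReal.ofReal (Real.exp (-r) * r ^ k / k.factorial) := by
  rw [poisPMF, Measure.toPMF_apply, poissonMeasure_singleton]

theorem tsum_poisPMF_mul_pow (r : NNReal) {z : ℝ} (hz : 0 ≤ z) :
    ∑' k, poisPMF r k * ENNReal.ofReal z ^ k = ENNReal.ofReal (Real.exp (r * (z - 1))) := by
  have hterm (k : ℕ) : poisPMF r k * ENNReal.ofReal z ^ k =
      ENNReal.ofReal (Real.exp (-r) * ((r * z) ^ k / k.factorial)) := by
    rw [poisPMF_apply, ← ENNReal.ofReal_pow hz, ← ENNReal.ofReal_mul (by positivity), mul_pow]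
    congr 1
    ring
  have hsum : HasSum (fun k : ℕ => Real.exp (-r) * ((r * z) ^ k / k.factorial))
      (Real.exp (r * (z - 1))) := by
    have h := (NormedSpace.expSeries_div_hasSum_exp ((r : ℝ) * z)).mul_left (Real.exp (-r))
    rw [← Real.exp_eq_exp_ℝ, ← Real.exp_add] at h
    convert! h using 2
    ring
  simp_rw [hterm]
  rw [← ENNReal.ofReal_tsum_of_nonneg (fun k => by positivity) hsum.summable, hsum.tsum_eq]

theorem poisPMF_tail_le (r : NNReal) {z : ℝ} (hz : 1 ≤ z) (T : ℕ) :
    (poisPMF r).toOuterMeasure {k | T < k} ≤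
      ENNReal.ofReal (Real.exp (r * (z - 1)) / z ^ T) := by
  have hz0 : 0 < z := by linarith
  have hzT : 0 < z ^ T := by positivity
  rw [ENNReal.ofReal_div_of_pos hzT, ENNReal.le_div_iff_mul_le
    (Or.inl (by simpa using hzT)) (Or.inl ENNReal.ofReal_ne_top),
    ← tsum_poisPMF_mul_pow r hz0.le, PMF.toOuterMeasure_apply, ← ENNReal.tsum_mul_right]
  refine ENNReal.tsum_le_tsum fun k => ?_
  by_cases hk : T < k
  · rw [Set.indicator_of_mem (by exact hk), ENNReal.ofReal_pow hz0.le]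
    exact mul_le_mul_right (pow_le_pow_right₀ (ENNReal.one_le_ofReal.2 hz) hk.le) _
  · rw [Set.indicator_of_notMem (by exact hk), zero_mul]
    exact zero_le

variable {E : Type*}

theorem sampleSet_void [DecidableEq E] (Q : PMF (Option E)) (A : Finset E) (r : ℕ) (S : Finset E) :
    (sampleSet Q r S).toOuterMeasure {S | Disjoint S A} =
      if Disjoint S A then Q.toOuterMeasure {o | ∀ f ∈ o, f ∉ A} ^ r else 0 := by
  induction r generalizing S with
  | zero => simp [sampleSet, PMF.toOuterMeasure_pure_apply]
  | succ r ih =>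
    have hdisj (o : Option E) :
        Disjoint (addSample o S) A ↔ o ∈ {o : Option E | ∀ f ∈ o, f ∉ A} ∧ Disjoint S A := by
      cases o <;> simp [addSample, Finset.disjoint_insert_left]
    rw [sampleSet, PMF.toOuterMeasure_bind_apply]
    simp only [ih, hdisj]
    by_cases hS : Disjoint S A
    · simp only [hS, and_true, if_true, pow_succ', PMF.toOuterMeasure_apply Q,
        ← ENNReal.tsum_mul_right, Set.indicator_apply, mul_ite, ite_mul, mul_zero, zero_mul]
    · simp [hS]

variable [Fintype E]

/-- The law of a sample which is `f` with probability `q f`, and void otherwise. -/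
def samplePMF (q : E → NNReal) (hq : ∑ f, q f ≤ 1) : PMF (Option E) :=
  PMF.ofFintype (fun o => o.elim (1 - ∑ f, q f : NNReal) fun f => q f) <| by
    rw [Fintype.sum_option]
    simp only [Option.elim_none, Option.elim_some]
    exact_mod_cast tsub_add_cancel_of_le hq

theorem samplePMF_some (q : E → NNReal) (hq : ∑ f, q f ≤ 1) (f : E) :
    samplePMF q hq (some f) = q f := rfl

theorem samplePMF_void (q : E → NNReal) (hq : ∑ f, q f ≤ 1) (A : Finset E) :
    (samplePMF q hq).toOuterMeasure {o | ∀ f ∈ o, f ∉ A} =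
      ENNReal.ofReal (1 - ∑ f ∈ A, (q f : ℝ)) := by
  classical
  have hsplit : ∑ f ∈ A, (q f : ℝ) + ∑ f ∈ Aᶜ, (q f : ℝ) = ∑ f, (q f : ℝ) :=
    Finset.sum_add_sum_compl A _
  have hmass : (samplePMF q hq).toOuterMeasure {o | ∀ f ∈ o, f ∉ A} =
      ((1 - ∑ f, q f + ∑ f ∈ Aᶜ, q f : NNReal) : ENNReal) := by
    rw [PMF.toOuterMeasure_apply, tsum_fintype, Fintype.sum_option]
    simp [Set.indicator_apply, samplePMF, Finset.sum_ite, Finset.filter_not,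
      Finset.compl_eq_univ_sdiff]
  rw [hmass, ← ENNReal.ofReal_coe_nnreal, NNReal.coe_add, NNReal.coe_sub hq]
  push_cast
  congr 1
  linarith

variable [DecidableEq E]

/-- The set of edges among a Poisson number, of mean `r`, of independent samples from `Q`. -/
def poisSet (r : NNReal) (Q : PMF (Option E)) : PMF (Finset E) :=
  (poisPMF r).bind fun N => sampleSet Q N ∅

theorem poisSet_void (r : NNReal) (q : E → NNReal) (hq : ∑ f, q f ≤ 1) (A : Finset E) :
    (poisSet r (samplePMF q hq)).toOuterMeasure {S | Disjoint S A} =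
      ENNReal.ofReal (∏ f ∈ A, Real.exp (-(r * q f))) := by
  rw [poisSet, PMF.toOuterMeasure_bind_apply]
  simp only [sampleSet_void, Finset.disjoint_empty_left, if_true, samplePMF_void]
  have hA : ∑ f ∈ A, (q f : ℝ) ≤ 1 := by
    exact_mod_cast (Finset.sum_le_univ_sum_of_nonneg (f := q) fun _ => zero_le).trans hq
  rw [tsum_poisPMF_mul_pow _ (by linarith), ← Real.exp_sum, Finset.sum_neg_distrib,
    ← Finset.mul_sum]
  congr 2
  ring

end Poisson

section Potential

variable {m : ℕ} {y : ℝ} {s t : ℕ}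

/-- The probability generating function at `y` of the indicator that an edge unexposed at time `t`
is still unexposed at time `s`, when one of `m` edges is exposed at each step. -/
def survivalPgf (m : ℕ) (y : ℝ) (s t : ℕ) : ℝ := 1 - (1 - y) * ((m - s) / (m - t))

theorem survivalPgf_self (ht : t < m) : survivalPgf m y t t = y := by
  have ht' : (t : ℝ) < m := by exact_mod_cast ht
  rw [survivalPgf, div_self (sub_pos.2 ht').ne']
  ring

theorem survivalPgf_mem_Icc (hy : y ∈ Set.Icc 0 1) (hts : t ≤ s) (hsm : s < m) :
    survivalPgf m y s t ∈ Set.Icc 0 1 := by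
  have hts' : (t : ℝ) ≤ s := by exact_mod_cast hts
  have hsm' : (s : ℝ) < m := by exact_mod_cast hsm
  have hle : ((m : ℝ) - s) / (m - t) ≤ 1 := (div_le_one (by linarith)).2 (by linarith)
  have hnonneg : 0 ≤ ((m : ℝ) - s) / (m - t) := div_nonneg (by linarith) (by linarith)
  constructor <;> unfold survivalPgf <;> nlinarith [hy.1, hy.2]

theorem survivalPgf_succ (hts : t + 1 ≤ s) (hsm : s < m) :
    survivalPgf m y s (t + 1) + (1 - survivalPgf m y s (t + 1)) / (m - t) =
      survivalPgf m y s t := by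
  have hts' : (t : ℝ) + 1 ≤ s := by exact_mod_cast hts
  have hsm' : (s : ℝ) < m := by exact_mod_cast hsm
  have h₀ : (m : ℝ) - t ≠ 0 := by linarith
  have h₁ : (m : ℝ) - (t + 1) ≠ 0 := by linarith
  unfold survivalPgf
  push_cast
  field_simp
  ring

variable {E : Type*} [DecidableEq E] {R : Finset (Finset E)} {H : Finset E} {ι : Type*}

theorem card_sdiff_inter {H G : Finset E} (hHG : H ⊆ G) (A : Finset E) :
    ((G \ H) ∩ A).card = (G ∩ A).card - (H ∩ A).card := by
  rw [← Finset.card_sdiff_of_subset (Finset.inter_subset_inter_right hHG)]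
  congr 1
  grind

theorem sum_pow_card_insert_inter {m : ℕ} (hR : ∀ G ∈ R, G.card = m) (hm : H.card ≤ m)
    {A : Finset E} {a : ℕ} (hA : ∀ G ∈ R, (G ∩ A).card = a) {G : Finset E} (hG : G ∈ above R H)
    (z : ℝ) {r : ℕ} (hr : r = a - (H ∩ A).card) :
    ∑ f ∈ G \ H, z ^ (a - (insert f H ∩ A).card) =
      r * z ^ (r - 1) + (m - H.card - r) * z ^ r := by
  have hcard : ((G \ H) ∩ A).card = r := by
    rw [card_sdiff_inter (mem_above.1 hG).2, hA G (mem_above.1 hG).1, hr]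
  have hcard' : (((G \ H) \ A).card : ℝ) = m - H.card - r := by
    rw [← Nat.cast_sub hm, ← card_sdiff_of_mem_above hR hG, ← hcard,
      ← Finset.card_sdiff_add_card_inter (G \ H) A]
    push_cast
    ring
  rw [← Finset.sum_inter_add_sum_sdiff (G \ H) A, ← hcard', ← hcard, ← nsmul_eq_mul,
    ← nsmul_eq_mul, hcard]
  congr 1
  · rw [← hcard]
    refine Finset.sum_eq_card_nsmul fun f hf => ?_
    have hf : f ∉ H ∧ f ∈ A := by grind
    rw [Finset.insert_inter_of_mem hf.2, Finset.card_insert_of_notMem (by simp [hf.1]), hcard, hr,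
      Nat.sub_sub]
  · refine Finset.sum_eq_card_nsmul fun f hf => ?_
    rw [Finset.insert_inter_of_notMem (Finset.mem_sdiff.1 hf).2, hr]

theorem sum_nextEdge_mul_pow_le [Fintype E] (hR : ∀ G ∈ R, G.card = m) (hH : (above R H).Nonempty)
    (hm : H.card < m) {A : Finset E} {a : ℕ} (hA : ∀ G ∈ R, (G ∩ A).card = a) {z : ℝ}
    (hz : z ∈ Set.Icc 0 1) :
    ∑ f, nextEdge R m H f * z ^ (a - (insert f H ∩ A).card) ≤
      (z + (1 - z) / (m - H.card)) ^ (a - (H ∩ A).card) := by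
  obtain ⟨r, hr⟩ : ∃ r, r = a - (H ∩ A).card := ⟨_, rfl⟩
  have hm' : (0 : ℝ) < m - H.card := sub_pos.2 (by exact_mod_cast hm)
  have hcard : ((above R H).card : ℝ) ≠ 0 := Nat.cast_ne_zero.2 hH.card_pos.ne'
  calc ∑ f, nextEdge R m H f * z ^ (a - (insert f H ∩ A).card)
      = (r * z ^ (r - 1) + (m - H.card - r) * z ^ r) / (m - H.card) := by
        rw [sum_nextEdge_mul,
          Finset.sum_congr rfl fun G hG => sum_pow_card_insert_inter hR hm.le hA hG z hr,
          Finset.sum_const, nsmul_eq_mul, mul_div_mul_left _ _ hcard, Nat.cast_sub hm.le]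
    _ = z ^ r + r * z ^ (r - 1) * ((1 - z) / (m - H.card)) := by
        rcases r with _ | r
        · simp [div_self hm'.ne']
        · rw [Nat.add_sub_cancel, pow_succ]
          field_simp
          ring
    _ ≤ (z + (1 - z) / (m - H.card)) ^ r := by
        have h1z : 0 ≤ 1 - z := sub_nonneg.2 hz.2
        have hz0 := hz.1
        exact pow_add_mul_le_add_pow hz0 (by positivity) r
    _ = _ := by rw [hr]

variable {T : ℕ} {A : ι → Finset E} {a : ι → ℕ} {θ : ι → ℕ → ℝ}

theorem potential_term_nonneg (hT : T ≤ m) (hy : y ∈ Set.Icc 0 1)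
    (hs : s ∈ Finset.Ico H.card T) (j : ι) :
    0 ≤ y ^ (-θ j s) * survivalPgf m y s H.card ^ (a j - (H ∩ A j).card) := by
  obtain ⟨hts, hsT⟩ := Finset.mem_Ico.1 hs
  exact mul_nonneg (Real.rpow_nonneg hy.1 _)
    (pow_nonneg (survivalPgf_mem_Icc hy hts (hsT.trans_le hT)).1 _)

variable [Fintype ι]

/-- A bound for the probability that, exposing further edges from `H` on, at some time `s < T` there
is a `j` such that at most `θ j s` edges of `A j`, out of `a j`, are unexposed: each of these events
contributes its exponential Markov bound. -/
def potential (m T : ℕ) (y : ℝ) (A : ι → Finset E) (a : ι → ℕ) (θ : ι → ℕ → ℝ) (H : Finset E) :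
    ℝ :=
  ∑ s ∈ Finset.Ico H.card T, ∑ j,
    y ^ (-θ j s) * survivalPgf m y s H.card ^ (a j - (H ∩ A j).card)

theorem potential_nonneg (hT : T ≤ m) (hy : y ∈ Set.Icc 0 1) : 0 ≤ potential m T y A a θ H :=
  Finset.sum_nonneg fun _ hs => Finset.sum_nonneg fun j _ => potential_term_nonneg hT hy hs j

theorem one_le_potential (hT : T ≤ m) (hy : y ∈ Set.Ioc 0 1) (hH : H.card < T) {j : ι}
    (hj : ((a j - (H ∩ A j).card : ℕ) : ℝ) ≤ θ j H.card) : 1 ≤ potential m T y A a θ H := by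
  have hy' := Set.Ioc_subset_Icc_self hy
  have hmem : H.card ∈ Finset.Ico H.card T := Finset.left_mem_Ico.2 hH
  calc 1 ≤ y ^ (-θ j H.card) * survivalPgf m y H.card H.card ^ (a j - (H ∩ A j).card) := by
        rw [survivalPgf_self (hH.trans_le hT), ← Real.rpow_natCast, ← Real.rpow_add hy.1]
        exact Real.one_le_rpow_of_pos_of_le_one_of_nonpos hy.1 hy.2 (by linarith)
    _ ≤ ∑ j, y ^ (-θ j H.card) * survivalPgf m y H.card H.card ^ (a j - (H ∩ A j).card) :=
        Finset.single_le_sum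
          (f := fun j => y ^ (-θ j H.card) * survivalPgf m y H.card H.card ^ (a j - (H ∩ A j).card))
          (fun j _ => potential_term_nonneg hT hy' hmem j) (Finset.mem_univ j)
    _ ≤ potential m T y A a θ H :=
        Finset.single_le_sum (f := fun s => ∑ j,
            y ^ (-θ j s) * survivalPgf m y s H.card ^ (a j - (H ∩ A j).card))
          (fun s hs => Finset.sum_nonneg fun j _ => potential_term_nonneg hT hy' hs j) hmem

theorem sum_nextEdge_mul_potential_le [Fintype E] (hR : ∀ G ∈ R, G.card = m)
    (hRH : (above R H).Nonempty) (hT : T ≤ m) (hy : y ∈ Set.Icc 0 1)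
    (hA : ∀ j, ∀ G ∈ R, (G ∩ A j).card = a j) (hH : H.card < T) :
    ∑ f, nextEdge R m H f * potential m T y A a θ (insert f H) ≤ potential m T y A a θ H := by
  have hexpand (f : E) : nextEdge R m H f * potential m T y A a θ (insert f H) =
      ∑ s ∈ Finset.Ico (H.card + 1) T, ∑ j, y ^ (-θ j s) *
        (nextEdge R m H f *
          survivalPgf m y s (H.card + 1) ^ (a j - (insert f H ∩ A j).card)) := by
    by_cases h0 : nextEdge R m H f = 0
    · simp [h0]
    · rw [potential, Finset.card_insert_of_notMem (above_insert_nonempty h0).1]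
      simp only [Finset.mul_sum, mul_left_comm]
  calc ∑ f, nextEdge R m H f * potential m T y A a θ (insert f H)
      = ∑ s ∈ Finset.Ico (H.card + 1) T, ∑ j, y ^ (-θ j s) * ∑ f, nextEdge R m H f *
          survivalPgf m y s (H.card + 1) ^ (a j - (insert f H ∩ A j).card) := by
        simp only [hexpand, Finset.mul_sum]
        rw [Finset.sum_comm]
        exact Finset.sum_congr rfl fun s _ => Finset.sum_comm
    _ ≤ ∑ s ∈ Finset.Ico (H.card + 1) T, ∑ j,
          y ^ (-θ j s) * survivalPgf m y s H.card ^ (a j - (H ∩ A j).card) := by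
        refine Finset.sum_le_sum fun s hs => Finset.sum_le_sum fun j _ => ?_
        obtain ⟨hts, hsT⟩ := Finset.mem_Ico.1 hs
        have hsm : s < m := hsT.trans_le hT
        rw [← survivalPgf_succ hts hsm]
        exact mul_le_mul_of_nonneg_left (sum_nextEdge_mul_pow_le hR hRH (hH.trans_le hT) (hA j)
          (survivalPgf_mem_Icc hy hts hsm)) (Real.rpow_nonneg hy.1 _)
    _ ≤ potential m T y A a θ H :=
        Finset.sum_le_sum_of_subset_of_nonneg (Finset.Ico_subset_Ico_left (Nat.le_succ _))
          fun s hs _ => Finset.sum_nonneg fun j _ => potential_term_nonneg hT hy hs j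

end Potential

section EdgeSets

theorem sum_le_sum_initial {n : ℕ} {d : Fin n → ℕ} (hd : Antitone d) {k : ℕ} {S : Finset (Fin n)}
    (hS : S.card ≤ k) : ∑ i ∈ S, d i ≤ ∑ i : Fin n, if i.val < k then d i else 0 := by
  obtain ⟨φ, hφ⟩ : ∃ φ : Fin S.card ↪o Fin n, Finset.univ.map φ.toEmbedding = S :=
    ⟨S.orderEmbOfFin rfl, Finset.map_orderEmbOfFin_univ S rfl⟩
  have hSn : S.card ≤ n := by simpa using S.card_le_univ
  have hle (i : ℕ) (hi : i < S.card) : i ≤ (φ ⟨i, hi⟩).val := by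
    induction i with
    | zero => exact Nat.zero_le _
    | succ i ih =>
      exact (ih (by omega)).trans_lt (φ.strictMono (Fin.mk_lt_mk.2 (Nat.lt_succ_self i)))
  calc ∑ i ∈ S, d i = ∑ i : Fin S.card, d (φ i) := by
        conv_lhs => rw [← hφ, Finset.sum_map]
        rfl
    _ ≤ ∑ i : Fin S.card, d (Fin.castLE hSn i) := Finset.sum_le_sum fun i _ => hd (hle i i.isLt)
    _ = ∑ i ∈ Finset.univ.map (Fin.castLEEmb hSn), d i :=
        (Finset.sum_map Finset.univ (Fin.castLEEmb hSn) d).symm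
    _ ≤ ∑ i ∈ Finset.univ.filter (fun i : Fin n => i.val < k), d i := by
        refine Finset.sum_le_sum_of_subset fun i hi => ?_
        obtain ⟨i, -, rfl⟩ := Finset.mem_map.1 hi
        exact Finset.mem_filter.2 ⟨Finset.mem_univ _, i.isLt.trans_le hS⟩
    _ = _ := Finset.sum_filter _ _

variable {V : Type*}

theorem card_filter_sym2Mk_eq [Fintype V] [DecidableEq V] {e : Sym2 V} (he : ¬ e.IsDiag) :
    (Finset.univ.filter fun x : V × V => s(x.1, x.2) = e).card = 2 := by
  induction e with
  | _ u w =>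
    have huw : u ≠ w := by simpa using he
    have hfiber : (Finset.univ.filter fun x : V × V => s(x.1, x.2) = s(u, w)) =
        {(u, w), (w, u)} := by
      ext ⟨x, y⟩
      simp
    rw [hfiber, Finset.card_pair (by simp [huw])]

theorem sum_sum_sym2Mk [Fintype V] {M : Type*} [AddCommMonoid M] {f : Sym2 V → M}
    (hf : ∀ e, e.IsDiag → f e = 0) : ∑ v, ∑ a, f s(v, a) = 2 • ∑ e, f e := by
  classical
  rw [← Fintype.sum_prod_type' fun v a => f s(v, a),
    ← Finset.sum_fiberwise Finset.univ (fun x : V × V => s(x.1, x.2)), Finset.smul_sum]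
  refine Finset.sum_congr rfl fun e _ => ?_
  by_cases he : e.IsDiag
  · rw [hf e he, smul_zero]
    exact Finset.sum_eq_zero fun x hx => by rw [(Finset.mem_filter.1 hx).2, hf e he]
  · rw [← card_filter_sym2Mk_eq he]
    exact Finset.sum_eq_card_nsmul fun x hx => by rw [(Finset.mem_filter.1 hx).2]

variable [DecidableEq V]

/-- The degree of `v` in the edge set `A`. -/
def edgeDeg (A : Finset (Sym2 V)) (v : V) : ℕ := (A.filter (v ∈ ·)).card

theorem edgeDeg_empty : edgeDeg (∅ : Finset (Sym2 V)) = 0 := rfl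

theorem edgeDeg_mono {A B : Finset (Sym2 V)} (h : A ⊆ B) : edgeDeg A ≤ edgeDeg B :=
  fun _ => Finset.card_le_card (Finset.filter_subset_filter _ h)

theorem edgeDeg_union {A B : Finset (Sym2 V)} (h : Disjoint A B) :
    edgeDeg (A ∪ B) = edgeDeg A + edgeDeg B := by
  ext v
  rw [edgeDeg, Finset.filter_union,
    Finset.card_union_of_disjoint (Finset.disjoint_filter_filter h)]
  rfl

theorem edgeDeg_sdiff_add {A B : Finset (Sym2 V)} (h : B ⊆ A) :
    edgeDeg (A \ B) + edgeDeg B = edgeDeg A := by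
  rw [← edgeDeg_union Finset.sdiff_disjoint, Finset.sdiff_union_of_subset h]

theorem edgeDeg_insert {A : Finset (Sym2 V)} {u w : V} (h : s(u, w) ∉ A) (huw : u ≠ w) :
    edgeDeg (insert s(u, w) A) = edgeDeg A + (Pi.single u 1 + Pi.single w 1) := by
  rw [Finset.insert_eq, edgeDeg_union (Finset.disjoint_singleton_left.2 h), add_comm]
  congr 1
  ext v
  rw [edgeDeg, Finset.filter_singleton]
  simp only [Sym2.mem_iff, Pi.add_apply, Pi.single_apply]
  grind

variable [Fintype V]

/-- The neighbours of `v` in the edge set `A`. -/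
def nbrs (A : Finset (Sym2 V)) (v : V) : Finset V := Finset.univ.filter fun a => s(v, a) ∈ A

/-- The oriented edges of the edge set `A`. -/
def arcs (A : Finset (Sym2 V)) : Finset (V × V) := Finset.univ.filter fun x => s(x.1, x.2) ∈ A

@[simp] theorem mem_nbrs {A : Finset (Sym2 V)} {v a : V} : a ∈ nbrs A v ↔ s(v, a) ∈ A := by
  simp [nbrs]

@[simp] theorem mem_arcs {A : Finset (Sym2 V)} {x : V × V} : x ∈ arcs A ↔ s(x.1, x.2) ∈ A := by
  simp [arcs]

theorem card_nbrs (A : Finset (Sym2 V)) (v : V) : (nbrs A v).card = edgeDeg A v := by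
  refine Finset.card_bij (fun a _ => s(v, a)) (fun a ha => ?_) (fun a _ b _ h => ?_)
    fun e he => ?_
  · simpa using ha
  · exact Sym2.congr_right.1 h
  · obtain ⟨heA, a, rfl⟩ := Finset.mem_filter.1 he
    exact ⟨a, mem_nbrs.2 heA, rfl⟩

theorem card_arcs_filter_fst (A : Finset (Sym2 V)) (S : Finset V) :
    ((arcs A).filter fun x => x.1 ∈ S).card = ∑ v ∈ S, edgeDeg A v := by
  have hsigma : (arcs A).filter (fun x => x.1 ∈ S) =
      (S.sigma fun v => nbrs A v).map (Equiv.sigmaEquivProd V V).toEmbedding := by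
    ext ⟨x, y⟩
    simp [and_comm]
  rw [hsigma, Finset.card_map, Finset.card_sigma]
  exact Finset.sum_congr rfl fun v _ => card_nbrs A v

theorem card_arcs_filter_snd (A : Finset (Sym2 V)) (S : Finset V) :
    ((arcs A).filter fun x => x.2 ∈ S).card = ∑ v ∈ S, edgeDeg A v := by
  rw [← card_arcs_filter_fst]
  refine Finset.card_equiv (Equiv.prodComm V V) fun x => ?_
  simp [Sym2.eq_swap]

theorem card_arcs {A : Finset (Sym2 V)} (hA : ∀ e ∈ A, ¬ e.IsDiag) :
    (arcs A).card = 2 * A.card := by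
  have h := sum_sum_sym2Mk (f := fun e => if e ∈ A then 1 else 0) fun e he =>
    if_neg fun heA => hA e heA he
  rw [← Fintype.sum_prod_type' fun v a => if s(v, a) ∈ A then 1 else 0] at h
  rwa [← Finset.card_filter, Finset.sum_ite_mem, Finset.univ_inter, ← Finset.card_eq_sum_ones,
    smul_eq_mul] at h

theorem sum_edgeDeg {A : Finset (Sym2 V)} (hA : ∀ e ∈ A, ¬ e.IsDiag) :
    ∑ v, edgeDeg A v = 2 * A.card := by
  simp only [← card_arcs hA, ← card_arcs_filter_fst, Finset.mem_univ, Finset.filter_true]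

end EdgeSets

section EdgeFamily

theorem exists_add_single_le {ι : Type*} [DecidableEq ι] {f g : ι → ℕ} (h : f < g) :
    ∃ i, f + Pi.single i 1 ≤ g := by
  obtain ⟨hle, i, hi⟩ := Pi.lt_def.1 h
  refine ⟨i, fun j => ?_⟩
  have hj := hle j
  rw [Pi.add_apply, Pi.single_apply]
  grind

variable {V : Type*} [DecidableEq V] {d : V → ℕ}

/-- `G` is the edge set of a simple graph with degrees at most `d`. -/
def IsSubrealization (d : V → ℕ) (G : Finset (Sym2 V)) : Prop :=
  (∀ e ∈ G, ¬ e.IsDiag) ∧ edgeDeg G ≤ d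

theorem IsSubrealization.insert_edge {G : Finset (Sym2 V)} (hG : IsSubrealization d G) {u w : V}
    (huw : u ≠ w) (hnotMem : s(u, w) ∉ G)
    (hd : edgeDeg G + (Pi.single u 1 + Pi.single w 1) ≤ d) :
    IsSubrealization d (insert s(u, w) G) := by
  refine ⟨fun e he => ?_, (edgeDeg_insert hnotMem huw).trans_le hd⟩
  rcases Finset.mem_insert.1 he with rfl | he
  · simpa using huw
  · exact hG.1 e he

variable [Fintype V] {K : ℕ}

/-- The edge sets of the simple graphs with degree sequence `d`. -/
def edgeFamily (d : V → ℕ) : Finset (Finset (Sym2 V)) :=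
  Finset.univ.filter fun G => (∀ e ∈ G, ¬ e.IsDiag) ∧ edgeDeg G = d

theorem mem_edgeFamily {G : Finset (Sym2 V)} :
    G ∈ edgeFamily d ↔ (∀ e ∈ G, ¬ e.IsDiag) ∧ edgeDeg G = d := by
  simp [edgeFamily]

/-- `K` bounds the sum of `d` over closed neighbourhoods in graphs with degrees at most `d`. -/
def NbhdBound (d : V → ℕ) (K : ℕ) : Prop :=
  ∀ G : Finset (Sym2 V), edgeDeg G ≤ d → ∀ a, ∑ v ∈ insert a (nbrs G a), d v ≤ K

theorem nbhdBound_two_mul_J {n : ℕ} {d : Fin n → ℕ} (hd : Antitone d) :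
    NbhdBound d (2 * J d) := by
  intro G hG a
  have hJ {S : Finset (Fin n)} (hS : S.card ≤ maxDeg d) : ∑ v ∈ S, d v ≤ J d :=
    sum_le_sum_initial hd hS
  have hda : d a ≤ maxDeg d := Finset.le_sup (Finset.mem_univ a)
  have hself : d a ≤ J d := by
    rcases Nat.eq_zero_or_pos (d a) with h | h
    · exact h ▸ Nat.zero_le _
    · simpa using hJ (S := {a}) (h.trans_le hda)
  calc ∑ v ∈ insert a (nbrs G a), d v ≤ d a + ∑ v ∈ nbrs G a, d v := by
        by_cases h : a ∈ nbrs G a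
        · simp [Finset.insert_eq_of_mem h]
        · exact (Finset.sum_insert h).le
    _ ≤ J d + J d := add_le_add hself (hJ ((card_nbrs G a).trans_le ((hG a).trans hda)))
    _ = 2 * J d := (two_mul _).symm

/-- The arcs `(x, y)` of `A` such that `ax` and `by` can be added to `G`. -/
def switchArcs (G A : Finset (Sym2 V)) (a b : V) : Finset (V × V) :=
  (arcs A).filter fun x => x.1 ∉ insert a (nbrs G a) ∧ x.2 ∉ insert b (nbrs G b)

theorem mem_switchArcs {G A : Finset (Sym2 V)} {a b x y : V} :
    (x, y) ∈ switchArcs G A a b ↔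
      s(x, y) ∈ A ∧ (x ≠ a ∧ s(a, x) ∉ G) ∧ y ≠ b ∧ s(b, y) ∉ G := by
  simp [switchArcs]

theorem card_arcs_le_card_switchArcs (hK : NbhdBound d K) {G A : Finset (Sym2 V)}
    (hG : edgeDeg G ≤ d) (hA : A ⊆ G) (a b : V) :
    (arcs A).card ≤ (switchArcs G A a b).card + 2 * K := by
  have hnbhd (c : V) : ∑ v ∈ insert c (nbrs G c), edgeDeg A v ≤ K :=
    (Finset.sum_le_sum fun v _ => ((edgeDeg_mono hA).trans hG) v).trans (hK G hG c)
  have hcover : arcs A ⊆ switchArcs G A a b ∪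
      (((arcs A).filter fun x => x.1 ∈ insert a (nbrs G a)) ∪
        ((arcs A).filter fun x => x.2 ∈ insert b (nbrs G b))) := by
    intro x hx
    simp only [switchArcs, Finset.mem_union, Finset.mem_filter, hx, true_and]
    tauto
  calc (arcs A).card ≤ (switchArcs G A a b).card +
        (((arcs A).filter fun x => x.1 ∈ insert a (nbrs G a)).card +
          ((arcs A).filter fun x => x.2 ∈ insert b (nbrs G b)).card) :=
        (Finset.card_le_card hcover).trans ((Finset.card_union_le _ _).trans
          (Nat.add_le_add_left (Finset.card_union_le _ _) _))
    _ ≤ (switchArcs G A a b).card + 2 * K := by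
        rw [card_arcs_filter_fst, card_arcs_filter_snd, two_mul]
        exact Nat.add_le_add_left (add_le_add (hnbhd a) (hnbhd b)) _

theorem IsSubrealization.exists_insert {G : Finset (Sym2 V)} (hG : IsSubrealization d G) {u w : V}
    (hu : edgeDeg G u < d u) (hw : edgeDeg G w < d w) (huw : w ∉ insert u (nbrs G u)) :
    ∃ G', IsSubrealization d G' ∧ G.card < G'.card := by
  obtain ⟨hne, hnotMem⟩ : w ≠ u ∧ s(u, w) ∉ G := by simpa using huw
  refine ⟨_, hG.insert_edge hne.symm hnotMem fun z => ?_,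
    (Finset.card_insert_of_notMem hnotMem).symm ▸ Nat.lt_succ_self _⟩
  have hz := hG.2 z
  simp only [Pi.add_apply, Pi.single_apply]
  grind

/-- The edge `xy` is rerouted through `u` and `v`, whose degrees grow by one. -/
theorem IsSubrealization.exists_reroute {G : Finset (Sym2 V)} (hG : IsSubrealization d G)
    {u v x y : V} (huv : edgeDeg G + (Pi.single u 1 + Pi.single v 1) ≤ d)
    (hxy : (x, y) ∈ switchArcs G G u v) :
    ∃ G', IsSubrealization d G' ∧ G.card < G'.card := by
  obtain ⟨hxyG, ⟨hxu, hux⟩, hyv, hvy⟩ := mem_switchArcs.1 hxy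
  have hxy' : x ≠ y := by simpa using hG.1 _ hxyG
  have hne : s(u, x) ≠ s(v, y) := by
    rw [Ne, Sym2.eq_iff]
    rintro (⟨-, h⟩ | ⟨rfl, rfl⟩)
    · exact hxy' h
    · exact hux (Sym2.eq_swap ▸ hxyG)
  have hvy' : s(v, y) ∉ G.erase s(x, y) := mt Finset.mem_of_mem_erase hvy
  have hux' : s(u, x) ∉ insert s(v, y) (G.erase s(x, y)) := by
    rw [Finset.mem_insert, not_or]
    exact ⟨hne, mt Finset.mem_of_mem_erase hux⟩
  refine ⟨insert s(u, x) (insert s(v, y) (G.erase s(x, y))), ⟨fun e he => ?_, ?_⟩, ?_⟩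
  · simp only [Finset.mem_insert] at he
    rcases he with rfl | rfl | he
    · simpa using hxu.symm
    · simpa using hyv.symm
    · exact hG.1 e (Finset.mem_of_mem_erase he)
  · have herase : edgeDeg (G.erase s(x, y)) + (Pi.single x 1 + Pi.single y 1) = edgeDeg G := by
      rw [← edgeDeg_insert (Finset.notMem_erase _ _) hxy', Finset.insert_erase hxyG]
    rw [edgeDeg_insert hux' hxu.symm, edgeDeg_insert hvy' hyv.symm]
    refine le_trans (le_of_eq ?_) huv
    rw [← herase]
    abel
  · rw [Finset.card_insert_of_notMem hux', Finset.card_insert_of_notMem hvy',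
      Finset.card_erase_add_one hxyG]
    exact Nat.lt_succ_self _

theorem IsSubrealization.exists_card_lt (hK : NbhdBound d K) (hKd : 3 * K < ∑ v, d v)
    {G : Finset (Sym2 V)} (hG : IsSubrealization d G) {u v : V}
    (huv : edgeDeg G + (Pi.single u 1 + Pi.single v 1) ≤ d) :
    ∃ G', IsSubrealization d G' ∧ G.card < G'.card := by
  have hu : edgeDeg G u < d u := by
    refine lt_of_lt_of_le ?_ (huv u)
    simp
  by_cases hclique : ∃ w ∉ insert u (nbrs G u), edgeDeg G w < d w
  · obtain ⟨w, hw, hdeg⟩ := hclique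
    exact hG.exists_insert hu hdeg hw
  push Not at hclique
  have hdeficit : ∑ v, d v ≤ ∑ v, edgeDeg G v + K :=
    calc ∑ v, d v ≤ ∑ v, (edgeDeg G v + if v ∈ insert u (nbrs G u) then d v else 0) := by
          refine Finset.sum_le_sum fun w _ => ?_
          split_ifs with hw
          · exact Nat.le_add_left _ _
          · exact hclique w hw
      _ ≤ ∑ v, edgeDeg G v + K := by
          rw [Finset.sum_add_distrib, Finset.sum_ite_mem, Finset.univ_inter]
          exact Nat.add_le_add_left (hK G hG.2 u) _
  have hswitch := card_arcs_le_card_switchArcs hK hG.2 subset_rfl u v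
  rw [card_arcs hG.1, ← sum_edgeDeg hG.1] at hswitch
  obtain ⟨⟨x, y⟩, hxy⟩ : (switchArcs G G u v).Nonempty := Finset.card_pos.1 (by omega)
  exact hG.exists_reroute huv hxy

theorem edgeFamily_nonempty (hK : NbhdBound d K) (heven : Even (∑ v, d v))
    (hKd : 3 * K < ∑ v, d v) : (edgeFamily d).Nonempty := by
  classical
  obtain ⟨G, hG, hmax⟩ := (Finset.univ.filter (IsSubrealization d)).exists_max_image Finset.card
    ⟨∅, by simp [IsSubrealization, edgeDeg_empty]⟩
  replace hG : IsSubrealization d G := (Finset.mem_filter.1 hG).2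
  refine ⟨G, mem_edgeFamily.2 ⟨hG.1, hG.2.eq_of_not_lt fun hlt => ?_⟩⟩
  obtain ⟨u, hu⟩ := exists_add_single_le hlt
  have hne : edgeDeg G + Pi.single u 1 ≠ d := by
    intro h
    have hodd : Odd (∑ v, d v) := by
      rw [← h]
      simp only [Pi.add_apply, Finset.sum_add_distrib, sum_edgeDeg hG.1]
      simp
    exact Nat.not_even_iff_odd.2 hodd heven
  obtain ⟨v, hv⟩ := exists_add_single_le (hu.lt_of_ne hne)
  rw [add_assoc] at hv
  obtain ⟨G', hG', hlt'⟩ := hG.exists_card_lt hK hKd hv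
  exact hlt'.not_ge (hmax G' (Finset.mem_filter.2 ⟨Finset.mem_univ _, hG'⟩))

end EdgeFamily

section Switching

variable {V : Type*} [DecidableEq V]

theorem edgeDeg_triple {u₁ w₁ u₂ w₂ u₃ w₃ : V} (h₁ : u₁ ≠ w₁) (h₂ : u₂ ≠ w₂) (h₃ : u₃ ≠ w₃)
    (h₁₂ : s(u₁, w₁) ≠ s(u₂, w₂)) (h₁₃ : s(u₁, w₁) ≠ s(u₃, w₃)) (h₂₃ : s(u₂, w₂) ≠ s(u₃, w₃)) :
    edgeDeg {s(u₁, w₁), s(u₂, w₂), s(u₃, w₃)} =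
      Pi.single u₁ 1 + Pi.single w₁ 1 + (Pi.single u₂ 1 + Pi.single w₂ 1) +
        (Pi.single u₃ 1 + Pi.single w₃ 1) := by
  rw [edgeDeg_insert (by simp [h₁₂, h₁₃]) h₁, edgeDeg_insert (by simpa using h₂₃) h₂,
    ← insert_empty_eq, edgeDeg_insert (by simp) h₃, edgeDeg_empty]
  abel

/-- The edges that a switching removes. -/
def switchOld (j k a b x y : V) : Finset (Sym2 V) := {s(j, a), s(k, b), s(x, y)}

/-- The edges that a switching adds. -/
def switchNew (j k a b x y : V) : Finset (Sym2 V) := {s(j, k), s(a, x), s(b, y)}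

/-- The switching of `G` that trades the edges `ja`, `kb`, `xy` for `jk`, `ax`, `by`. -/
def switch (G : Finset (Sym2 V)) (j k a b x y : V) : Finset (Sym2 V) :=
  (G \ switchOld j k a b x y) ∪ switchNew j k a b x y

variable [Fintype V] {d : V → ℕ} {K m : ℕ} {H G : Finset (Sym2 V)}

theorem card_of_mem_edgeFamily (hm : ∑ v, d v = 2 * m) (hG : G ∈ edgeFamily d) : G.card = m := by
  obtain ⟨hdiag, hdeg⟩ := mem_edgeFamily.1 hG
  have hsum := sum_edgeDeg hdiag
  rw [hdeg] at hsum
  omega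

/-- The edge `jk` can be switched into `G` through the unexposed edges `ja`, `kb`, `xy`, the edges
of `H` being those already exposed. -/
structure IsSwitchable (d : V → ℕ) (H G : Finset (Sym2 V)) (j k a b x y : V) : Prop where
  graph_mem : G ∈ above (edgeFamily d) H
  ne : j ≠ k
  notMem : s(j, k) ∉ G
  left_mem : s(j, a) ∈ G \ H
  right_mem : s(k, b) ∈ G \ H
  arc_mem : (x, y) ∈ switchArcs G (G \ H) a b

namespace IsSwitchable

variable {j k a b x y : V}

theorem switchOld_subset (h : IsSwitchable d H G j k a b x y) :
    switchOld j k a b x y ⊆ G \ H := by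
  simp only [switchOld, Finset.insert_subset_iff, Finset.singleton_subset_iff]
  exact ⟨h.left_mem, h.right_mem, (mem_switchArcs.1 h.arc_mem).1⟩

theorem disjoint_switchNew (h : IsSwitchable d H G j k a b x y) :
    Disjoint G (switchNew j k a b x y) := by
  obtain ⟨-, ⟨-, hax⟩, -, hby⟩ := mem_switchArcs.1 h.arc_mem
  simp only [switchNew, Finset.disjoint_insert_right, Finset.disjoint_singleton_right]
  exact ⟨h.notMem, hax, hby⟩

theorem not_isDiag_of_mem_switchNew (h : IsSwitchable d H G j k a b x y) {e : Sym2 V}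
    (he : e ∈ switchNew j k a b x y) : ¬ e.IsDiag := by
  obtain ⟨-, ⟨hxa, -⟩, hyb, -⟩ := mem_switchArcs.1 h.arc_mem
  simp only [switchNew, Finset.mem_insert, Finset.mem_singleton] at he
  rcases he with rfl | rfl | rfl
  · simpa using h.ne
  · simpa using hxa.symm
  · simpa using hyb.symm

theorem edgeDeg_switchNew (h : IsSwitchable d H G j k a b x y) :
    edgeDeg (switchNew j k a b x y) = edgeDeg (switchOld j k a b x y) := by
  have hjk := h.ne
  have hjkG := h.notMem
  have hdiag := (mem_edgeFamily.1 (mem_above.1 h.graph_mem).1).1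
  obtain ⟨hxyG, ⟨hxa, hax⟩, hyb, hby⟩ := mem_switchArcs.1 h.arc_mem
  replace hxyG := (Finset.mem_sdiff.1 hxyG).1
  have hjaG := (Finset.mem_sdiff.1 h.left_mem).1
  have hkbG := (Finset.mem_sdiff.1 h.right_mem).1
  have hja : j ≠ a := by simpa using hdiag _ hjaG
  have hkb : k ≠ b := by simpa using hdiag _ hkbG
  have hxy : x ≠ y := by simpa using hdiag _ hxyG
  have hswap (u w : V) : s(u, w) = s(w, u) := Sym2.eq_swap
  rw [switchNew, switchOld, edgeDeg_triple hjk hxa.symm hyb.symm,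
    edgeDeg_triple hja hkb hxy]
  · abel
  all_goals
    rw [Ne, Sym2.eq_iff]
    rintro (⟨rfl, rfl⟩ | ⟨rfl, rfl⟩) <;> grind

theorem switch_mem_above (h : IsSwitchable d H G j k a b x y) :
    switch G j k a b x y ∈ above (edgeFamily d) (insert s(j, k) H) := by
  obtain ⟨hG, hHG⟩ := mem_above.1 h.graph_mem
  obtain ⟨hdiag, hdeg⟩ := mem_edgeFamily.1 hG
  obtain ⟨hold, holdH⟩ := Finset.subset_sdiff.1 h.switchOld_subset
  refine mem_above.2 ⟨mem_edgeFamily.2 ⟨fun e he => ?_, ?_⟩, Finset.insert_subset ?_ ?_⟩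
  · rcases Finset.mem_union.1 he with he | he
    · exact hdiag e (Finset.sdiff_subset he)
    · exact h.not_isDiag_of_mem_switchNew he
  · rw [switch, edgeDeg_union (h.disjoint_switchNew.mono_left Finset.sdiff_subset),
      h.edgeDeg_switchNew, edgeDeg_sdiff_add hold, hdeg]
  · exact Finset.mem_union_right _ (by simp [switchNew])
  · exact (Finset.subset_sdiff.2 ⟨hHG, holdH.symm⟩).trans Finset.subset_union_left

theorem left_mem_arcs_switch (h : IsSwitchable d H G j k a b x y) :
    (a, x) ∈ arcs (switch G j k a b x y \ H) :=
  mem_arcs.2 <| Finset.mem_sdiff.2 ⟨Finset.mem_union_right _ (by simp [switchNew]),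
    fun hax => (mem_switchArcs.1 h.arc_mem).2.1.2 ((mem_above.1 h.graph_mem).2 hax)⟩

theorem right_mem_arcs_switch (h : IsSwitchable d H G j k a b x y) :
    (b, y) ∈ arcs (switch G j k a b x y \ H) :=
  mem_arcs.2 <| Finset.mem_sdiff.2 ⟨Finset.mem_union_right _ (by simp [switchNew]),
    fun hby => (mem_switchArcs.1 h.arc_mem).2.2.2 ((mem_above.1 h.graph_mem).2 hby)⟩

theorem switch_sdiff_union (h : IsSwitchable d H G j k a b x y) :
    switch G j k a b x y \ switchNew j k a b x y ∪ switchOld j k a b x y = G := by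
  rw [switch, Finset.union_sdiff_cancel_right (h.disjoint_switchNew.mono_left Finset.sdiff_subset),
    Finset.sdiff_union_of_subset (h.switchOld_subset.trans Finset.sdiff_subset)]

end IsSwitchable

theorem edgeDeg_sdiff_of_mem_above (hG : G ∈ above (edgeFamily d) H) :
    edgeDeg (G \ H) = d - edgeDeg H := by
  obtain ⟨hGd, hHG⟩ := mem_above.1 hG
  rw [← (mem_edgeFamily.1 hGd).2, ← edgeDeg_sdiff_add hHG, add_tsub_cancel_right]

theorem card_arcs_of_mem_above (hm : ∑ v, d v = 2 * m) (hG : G ∈ above (edgeFamily d) H) :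
    (arcs (G \ H)).card = 2 * (m - H.card) := by
  obtain ⟨hGd, hHG⟩ := mem_above.1 hG
  rw [card_arcs fun e he => (mem_edgeFamily.1 hGd).1 e (Finset.sdiff_subset he),
    Finset.card_sdiff_of_subset hHG, card_of_mem_edgeFamily hm hGd]

/-- The graphs and the choices `((a, b), (x, y))` for which `jk` can be switched in. -/
def switchings (d : V → ℕ) (H : Finset (Sym2 V)) (j k : V) :
    Finset (Σ _ : Finset (Sym2 V), Σ _ : V × V, V × V) :=
  ((above (edgeFamily d) H).filter (s(j, k) ∉ ·)).sigma fun G =>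
    (nbrs (G \ H) j ×ˢ nbrs (G \ H) k).sigma fun ab => switchArcs G (G \ H) ab.1 ab.2

theorem mem_switchings {j k a b x y : V} (hjk : j ≠ k) :
    ⟨G, (a, b), (x, y)⟩ ∈ switchings d H j k ↔ IsSwitchable d H G j k a b x y := by
  simp only [switchings, Finset.mem_sigma, Finset.mem_filter, Finset.mem_product, mem_nbrs]
  exact ⟨fun ⟨⟨hG, hn⟩, ⟨ha, hb⟩, hxy⟩ => ⟨hG, hjk, hn, ha, hb, hxy⟩,
    fun h => ⟨⟨h.graph_mem, h.notMem⟩, ⟨h.left_mem, h.right_mem⟩, h.arc_mem⟩⟩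

theorem card_switchings_ge (hK : NbhdBound d K) (hm : ∑ v, d v = 2 * m) (H : Finset (Sym2 V))
    (j k : V) :
    ((above (edgeFamily d) H).filter (s(j, k) ∉ ·)).card *
        ((d j - edgeDeg H j) * (d k - edgeDeg H k) * (2 * (m - H.card) - 2 * K)) ≤
      (switchings d H j k).card := by
  rw [switchings, Finset.card_sigma]
  refine Finset.card_nsmul_le_sum _ _ _ fun G hG => ?_
  have hG' := (Finset.mem_filter.1 hG).1
  obtain ⟨hGd, -⟩ := mem_above.1 hG'
  have hdeg (v : V) : d v - edgeDeg H v = (nbrs (G \ H) v).card := by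
    rw [card_nbrs, edgeDeg_sdiff_of_mem_above hG', Pi.sub_apply]
  rw [Finset.card_sigma, hdeg, hdeg, ← Finset.card_product]
  refine Finset.card_nsmul_le_sum _ _ _ fun ab _ => ?_
  rw [← card_arcs_of_mem_above hm hG', tsub_le_iff_right]
  exact card_arcs_le_card_switchArcs hK (mem_edgeFamily.1 hGd).2.le Finset.sdiff_subset _ _

theorem card_switchings_le (hm : ∑ v, d v = 2 * m) (H : Finset (Sym2 V)) {j k : V} (hjk : j ≠ k) :
    (switchings d H j k).card ≤
      (above (edgeFamily d) (insert s(j, k) H)).card * (2 * (m - H.card)) ^ 2 := by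
  let targets : Finset (Σ _ : Finset (Sym2 V), (V × V) × (V × V)) :=
    (above (edgeFamily d) (insert s(j, k) H)).sigma fun G => arcs (G \ H) ×ˢ arcs (G \ H)
  have htargets : targets.card =
      (above (edgeFamily d) (insert s(j, k) H)).card * (2 * (m - H.card)) ^ 2 := by
    rw [Finset.card_sigma]
    refine Finset.sum_const_nat fun G hG => ?_
    obtain ⟨hGd, hHG⟩ := mem_above.1 hG
    rw [Finset.card_product, sq, card_arcs_of_mem_above hm
      (mem_above.2 ⟨hGd, (Finset.subset_insert _ _).trans hHG⟩)]
  rw [← htargets]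
  refine Finset.card_le_card_of_injOn
    (fun p => ⟨switch p.1 j k p.2.1.1 p.2.1.2 p.2.2.1 p.2.2.2,
      (p.2.1.1, p.2.2.1), (p.2.1.2, p.2.2.2)⟩) ?_ ?_
  · rintro ⟨G, ⟨a, b⟩, x, y⟩ hp
    have h := (mem_switchings hjk).1 hp
    exact Finset.mem_sigma.2 ⟨h.switch_mem_above,
      Finset.mem_product.2 ⟨h.left_mem_arcs_switch, h.right_mem_arcs_switch⟩⟩
  · rintro ⟨G₁, ⟨a₁, b₁⟩, x₁, y₁⟩ hp₁ ⟨G₂, ⟨a₂, b₂⟩, x₂, y₂⟩ hp₂ heq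
    have h₁ := (mem_switchings hjk).1 hp₁
    have h₂ := (mem_switchings hjk).1 hp₂
    simp only [Sigma.mk.injEq, heq_eq_eq, Prod.mk.injEq] at heq
    obtain ⟨hswitch, ⟨rfl, rfl⟩, rfl, rfl⟩ := heq
    obtain rfl : G₁ = G₂ := by rw [← h₁.switch_sdiff_union, ← h₂.switch_sdiff_union, hswitch]
    rfl

theorem card_filter_notMem_mul_le (hK : NbhdBound d K) (hm : ∑ v, d v = 2 * m)
    (H : Finset (Sym2 V)) {j k : V} (hjk : j ≠ k) :
    ((above (edgeFamily d) H).filter (s(j, k) ∉ ·)).card *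
        ((d j - edgeDeg H j) * (d k - edgeDeg H k) * (2 * (m - H.card) - 2 * K)) ≤
      (above (edgeFamily d) (insert s(j, k) H)).card * (2 * (m - H.card)) ^ 2 :=
  (card_switchings_ge hK hm H j k).trans (card_switchings_le hm H hjk)

end Switching

section Density

theorem card_above_insert_add {E : Type*} [DecidableEq E] (R : Finset (Finset E)) (H : Finset E)
    (f : E) :
    (above R (insert f H)).card + ((above R H).filter (f ∉ ·)).card = (above R H).card := by
  rw [← Finset.card_filter_add_card_filter_not (s := above R H) (f ∈ ·)]
  congr 2
  ext G
  simp only [mem_above, Finset.mem_filter, Finset.insert_subset_iff]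
  tauto

theorem mul_div_add_le_div_add {c u M x z : ℝ} (hu : 0 ≤ u) (hM : 0 < M) (hc : c ≤ 1)
    (hx : 0 ≤ x) (hxz : 0 < x + z) (h : z * (c * u) ≤ x * M) : c * (u / (M + u)) ≤ x / (x + z) := by
  rw [← mul_div_assoc, div_le_div_iff₀ (by positivity) hxz]
  have hcx : c * (u * x) ≤ u * x := mul_le_of_le_one_left (by positivity) hc
  linarith

variable {V : Type*} [DecidableEq V] [Fintype V] {d : V → ℕ} {K m : ℕ} {κ : NNReal}
  {H : Finset (Sym2 V)} {j k : V}

/-- No vertex has lost much more than the expected part of its degree to the exposed set `H`. -/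
def IsBalanced (d : V → ℕ) (m : ℕ) (κ : NNReal) (H : Finset (Sym2 V)) : Prop :=
  ∀ j, κ * (((m - H.card : ℕ) : ℝ) / m) * d j ≤ (d j - edgeDeg H j : ℕ)

theorem IsBalanced.card_filter_notMem_mul_le (hgood : IsBalanced d m κ H) (hK : NbhdBound d K)
    (hm : ∑ v, d v = 2 * m) (hHm : H.card < m) (hKH : K ≤ (1 - κ : ℝ) * (m - H.card : ℕ))
    (hjk : j ≠ k) :
    (((above (edgeFamily d) H).filter (s(j, k) ∉ ·)).card : ℝ) *
        (κ ^ 3 * (((m - H.card : ℕ) : ℝ) / m) * (d j * d k)) ≤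
      (above (edgeFamily d) (insert s(j, k) H)).card * (2 * m) := by
  have hm0 : (0 : ℝ) < m := by exact_mod_cast H.card.zero_le.trans_lt hHm
  have hswitch := DegSeq.card_filter_notMem_mul_le hK hm H hjk
  generalize ((above (edgeFamily d) H).filter (s(j, k) ∉ ·)).card = z at hswitch ⊢
  generalize (above (edgeFamily d) (insert s(j, k) H)).card = x at hswitch ⊢
  have hj := hgood j
  have hk := hgood k
  have hr : 0 < m - H.card := Nat.sub_pos_of_lt hHm
  generalize m - H.card = r at *
  have : (0 : ℝ) < r := by exact_mod_cast hr
  have hfree : κ * (2 * r) ≤ ((2 * r - 2 * K : ℕ) : ℝ) := by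
    have hsub : ((2 * r : ℕ) : ℝ) ≤ ((2 * r - 2 * K : ℕ) : ℝ) + (2 * K : ℕ) := by
      exact_mod_cast le_tsub_add
    push_cast at hsub
    linarith
  refine le_of_mul_le_mul_right ?_ (show 0 < 2 * r * (r / m : ℝ) by positivity)
  calc (z : ℝ) * (κ ^ 3 * (r / m) * (d j * d k)) * (2 * r * (r / m))
      = z * (κ * (r / m) * d j * (κ * (r / m) * d k) * (κ * (2 * r))) := by ring
    _ ≤ z * ((d j - edgeDeg H j : ℕ) * (d k - edgeDeg H k : ℕ) * (2 * r - 2 * K : ℕ)) := by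
        gcongr
    _ ≤ x * (2 * r) ^ 2 := by exact_mod_cast hswitch
    _ = x * (2 * m) * (2 * r * (r / m)) := by
        field_simp

/-- The entries of the matrix `P d`, as a function of the edge. -/
def pairP (d : V → ℕ) : Sym2 V → NNReal :=
  Sym2.lift ⟨fun j k => if j = k then 0 else d j * d k / ((∑ v, d v : ℕ) + d j * d k),
    fun j k => by simp only [eq_comm, mul_comm]⟩

theorem pairP_mk (d : V → ℕ) (j k : V) : pairP d s(j, k) =
    if j = k then 0 else (d j * d k / ((∑ v, d v : ℕ) + d j * d k) : NNReal) := rfl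

theorem sum_pairP_le (hm0 : m ≠ 0) (hm : ∑ v, d v = 2 * m) : ∑ e, pairP d e ≤ m := by
  have hdiag (e : Sym2 V) (he : e.IsDiag) : pairP d e = 0 := by
    induction e with
    | _ j k => rw [pairP_mk, if_pos (Sym2.mk_isDiag_iff.1 he)]
  suffices h : (2 : NNReal) * ∑ e, pairP d e ≤ 2 * m from le_of_mul_le_mul_left h two_pos
  have hsum : ∑ v, (d v : NNReal) = 2 * m := by exact_mod_cast hm
  calc (2 : NNReal) * ∑ e, pairP d e = ∑ v, ∑ a, pairP d s(v, a) := by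
        rw [sum_sum_sym2Mk hdiag, nsmul_eq_mul, Nat.cast_ofNat]
    _ ≤ ∑ v, ∑ a, (d v : NNReal) * d a / (2 * m) := by
        refine Finset.sum_le_sum fun v _ => Finset.sum_le_sum fun a _ => ?_
        rw [pairP_mk, hm]
        split_ifs
        · exact zero_le
        · push_cast
          exact div_le_div_of_nonneg_left zero_le (by positivity) le_self_add
    _ = 2 * m := by
        simp_rw [← Finset.sum_div, ← Finset.mul_sum, ← Finset.sum_mul, hsum]
        exact mul_self_div_self _

theorem IsBalanced.pairP_le_nextEdge (hgood : IsBalanced d m κ H) (hκ : κ ≤ 1)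
    (hK : NbhdBound d K) (hm : ∑ v, d v = 2 * m) (hHm : H.card < m)
    (hKH : K ≤ (1 - κ : ℝ) * (m - H.card : ℕ)) (hH : (above (edgeFamily d) H).Nonempty)
    {f : Sym2 V} (hf : f ∉ H) : κ ^ 3 / m * pairP d f ≤ nextEdge (edgeFamily d) m H f := by
  induction f with
  | _ j k =>
  rw [pairP_mk]
  split_ifs with hjk
  · simp
  have hm0 : (0 : ℝ) < m := by exact_mod_cast H.card.zero_le.trans_lt hHm
  have hcard := card_above_insert_add (edgeFamily d) H s(j, k)
  have hratio := hgood.card_filter_notMem_mul_le hK hm hHm hKH hjk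
  have hr : 0 < m - H.card := Nat.sub_pos_of_lt hHm
  have hrm : m - H.card ≤ m := Nat.sub_le _ _
  have hpos := hH.card_pos
  rw [nextEdge, if_neg hf, hm, ← NNReal.coe_le_coe, ← hcard]
  rw [← hcard] at hpos
  generalize ((above (edgeFamily d) H).filter (s(j, k) ∉ ·)).card = z at hratio hpos ⊢
  generalize (above (edgeFamily d) (insert s(j, k) H)).card = x at hratio hpos ⊢
  generalize m - H.card = r at *
  push_cast
  have hr0 : (0 : ℝ) < r := by exact_mod_cast hr
  have hc : (κ : ℝ) ^ 3 * (r / m) ≤ 1 :=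
    mul_le_one₀ (pow_le_one₀ κ.2 hκ) (by positivity) ((div_le_one hm0).2 (by exact_mod_cast hrm))
  have hdensity := mul_div_add_le_div_add (z := z) (by positivity) (by positivity) hc
    (Nat.cast_nonneg x) (by exact_mod_cast hpos) hratio
  rw [← div_div, le_div_iff₀ hr0]
  refine le_trans (le_of_eq ?_) hdensity
  ring

end Density

section Domination

open InformationTheory

theorem rpow_neg_mul_pow_le {κ p : ℝ} (hκ : 0 < κ) (hp : 0 ≤ 1 - (1 - κ) * p) (a : ℕ) :
    κ ^ (-(κ * p * a)) * (1 - (1 - κ) * p) ^ a ≤ Real.exp (-(klFun κ * p * a)) := by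
  have hpow : (1 - (1 - κ) * p) ^ a ≤ Real.exp (a * -((1 - κ) * p)) := by
    rw [Real.exp_nat_mul]
    exact pow_le_pow_left₀ hp (Real.one_sub_le_exp_neg _) a
  calc κ ^ (-(κ * p * a)) * (1 - (1 - κ) * p) ^ a
      ≤ κ ^ (-(κ * p * a)) * Real.exp (a * -((1 - κ) * p)) := by gcongr
    _ = Real.exp (-(klFun κ * p * a)) := by
        rw [Real.rpow_def_of_pos hκ, ← Real.exp_add, klFun]
        ring_nf

theorem rpow_neg_mul_survivalPgf_pow_le {κ D : ℝ} (h0 : 0 < κ) (h1 : κ ≤ 1) {s m a : ℕ}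
    (hsm : s < m) (hs : s ≤ κ * m) (hD0 : 0 ≤ D) (hD : D ≤ a) :
    κ ^ (-(κ * (((m - s : ℕ) : ℝ) / m) * a)) * survivalPgf m κ s 0 ^ a ≤
      Real.exp (-(klFun κ * (1 - κ) * D)) := by
  have hm : (0 : ℝ) < m := by exact_mod_cast s.zero_le.trans_lt hsm
  have hpgf : survivalPgf m κ s 0 = 1 - (1 - κ) * (((m - s : ℕ) : ℝ) / m) := by
    rw [survivalPgf, Nat.cast_sub hsm.le, Nat.cast_zero, sub_zero]
  have hp : 1 - κ ≤ ((m - s : ℕ) : ℝ) / m := by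
    rw [Nat.cast_sub hsm.le, le_div_iff₀ hm]
    linarith
  have hpgf0 : 0 ≤ survivalPgf m κ s 0 := (survivalPgf_mem_Icc ⟨h0.le, h1⟩ s.zero_le hsm).1
  have hkl : 0 ≤ klFun κ := klFun_nonneg h0.le
  have h1κ : 0 ≤ 1 - κ := sub_nonneg.2 h1
  rw [hpgf] at hpgf0 ⊢
  refine (rpow_neg_mul_pow_le h0 hpgf0 a).trans (Real.exp_le_exp.2 (neg_le_neg ?_))
  gcongr

theorem klFun_pos_of_lt_one {κ : ℝ} (h0 : 0 ≤ κ) (h1 : κ < 1) : 0 < klFun κ :=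
  (klFun_nonneg h0).lt_of_ne fun h => h1.ne ((klFun_eq_zero_iff h0).1 h.symm)

/-- Markov's inequality with `z = κ⁻¹` for a Poisson variable of mean `κ ^ 3 * M`. -/
theorem exp_div_pow_le {κ M : ℝ} (h0 : 0 < κ) (h1 : κ ≤ 1) {T : ℕ} (hT : κ * M ≤ T + 1) :
    Real.exp (κ ^ 3 * M * (κ⁻¹ - 1)) / κ⁻¹ ^ T ≤ Real.exp ((1 - κ) * (1 - κ * (1 - κ) * M)) := by
  have hlog : 1 - κ ≤ -Real.log κ := by linarith [Real.log_le_sub_one_of_pos h0]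
  rw [← Real.exp_log (pow_pos (inv_pos.2 h0) T), ← Real.exp_sub, Real.exp_le_exp, Real.log_pow,
    Real.log_inv]
  have hT' : (κ * M - 1) * (1 - κ) ≤ T * -Real.log κ :=
    mul_le_mul (by linarith) hlog (by linarith) (Nat.cast_nonneg T)
  have hmean : κ ^ 3 * M * (κ⁻¹ - 1) = κ ^ 2 * M * (1 - κ) := by
    field_simp
  rw [hmean]
  linarith

variable {V : Type*} [DecidableEq V] [Fintype V] {d : V → ℕ} {K m T : ℕ} {κ : NNReal}
  {H : Finset (Sym2 V)}

theorem card_inter_filter_mem (A : Finset (Sym2 V)) (v : V) :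
    (A ∩ Finset.univ.filter (v ∈ ·)).card = edgeDeg A v := by
  rw [edgeDeg, Finset.inter_filter, Finset.inter_univ]

/-- The potential that controls the degrees of the exposed graph during the first `T` steps. -/
def degreePotential (d : V → ℕ) (m T : ℕ) (κ : NNReal) (H : Finset (Sym2 V)) : ℝ :=
  potential m T κ (fun v => Finset.univ.filter (v ∈ ·)) d
    (fun v s => κ * (((m - s : ℕ) : ℝ) / m) * d v) H

theorem isBalanced_or_one_le_degreePotential (hT : T ≤ m) (h0 : 0 < κ) (h1 : κ ≤ 1)
    (hH : H.card < T) : IsBalanced d m κ H ∨ 1 ≤ degreePotential d m T κ H := by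
  refine or_iff_not_imp_left.2 fun hbad => ?_
  obtain ⟨v, hv⟩ := not_forall.1 hbad
  refine one_le_potential hT ⟨h0, h1⟩ hH (j := v) ?_
  rw [card_inter_filter_mem]
  exact (not_le.1 hv).le

theorem degreePotential_nonneg (hT : T ≤ m) (h1 : κ ≤ 1) : 0 ≤ degreePotential d m T κ H :=
  potential_nonneg hT ⟨κ.2, h1⟩

theorem degreePotential_empty_le (hT : T ≤ (κ * m : ℝ)) (hTm : T ≤ m) (h0 : 0 < κ) (h1 : κ ≤ 1)
    {D : ℝ} (hD0 : 0 ≤ D) (hD : ∀ v, D ≤ d v) : degreePotential d m T κ ∅ ≤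
      m * Fintype.card V * Real.exp (-(klFun κ * (1 - κ) * D)) := by
  have hterm (s : ℕ) (hs : s ∈ Finset.Ico 0 T) (v : V) :
      (κ : ℝ) ^ (-(κ * (((m - s : ℕ) : ℝ) / m) * d v)) * survivalPgf m κ s 0 ^ d v ≤
        Real.exp (-(klFun κ * (1 - κ) * D)) := by
    have hsT : s < T := (Finset.mem_Ico.1 hs).2
    exact rpow_neg_mul_survivalPgf_pow_le (NNReal.coe_pos.2 h0) h1 (hsT.trans_le hTm)
      (le_trans (by exact_mod_cast hsT.le) hT) hD0 (hD v)
  calc degreePotential d m T κ ∅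
      = ∑ s ∈ Finset.Ico 0 T, ∑ v, (κ : ℝ) ^ (-(κ * (((m - s : ℕ) : ℝ) / m) * d v)) *
          survivalPgf m κ s 0 ^ d v := by
        simp only [degreePotential, potential, Finset.card_empty, Finset.empty_inter, Nat.sub_zero]
    _ ≤ ∑ s ∈ Finset.Ico 0 T, ∑ v : V, Real.exp (-(klFun κ * (1 - κ) * D)) :=
        Finset.sum_le_sum fun s hs => Finset.sum_le_sum fun v _ => hterm s hs v
    _ = T * Fintype.card V * Real.exp (-(klFun κ * (1 - κ) * D)) := by
        simp [mul_assoc]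
    _ ≤ m * Fintype.card V * Real.exp (-(klFun κ * (1 - κ) * D)) := by
        gcongr

theorem sum_nextEdge_mul_ofReal_degreePotential_le (hm : ∑ v, d v = 2 * m)
    (hH : (above (edgeFamily d) H).Nonempty) (hT : T ≤ m) (h1 : κ ≤ 1) (hHT : H.card < T) :
    ∑ f, (nextEdge (edgeFamily d) m H f : ENNReal) *
        ENNReal.ofReal (degreePotential d m T κ (insert f H)) ≤
      ENNReal.ofReal (degreePotential d m T κ H) := by
  have hstep : ∑ f, nextEdge (edgeFamily d) m H f * degreePotential d m T κ (insert f H) ≤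
      degreePotential d m T κ H :=
    sum_nextEdge_mul_potential_le (fun G => card_of_mem_edgeFamily hm) hH hT ⟨κ.2, h1⟩
      (fun v G hG => by rw [card_inter_filter_mem, (mem_edgeFamily.1 hG).2]) hHT
  refine le_trans (le_of_eq ?_) (ENNReal.ofReal_le_ofReal hstep)
  rw [ENNReal.ofReal_sum_of_nonneg fun f _ => mul_nonneg (NNReal.coe_nonneg _)
    (degreePotential_nonneg hT h1)]
  refine Finset.sum_congr rfl fun f _ => ?_
  rw [ENNReal.ofReal_mul (NNReal.coe_nonneg _), ENNReal.ofReal_coe_nnreal]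

theorem sum_scaled_pairP_le_one (hm0 : m ≠ 0) (hm : ∑ v, d v = 2 * m) (h1 : κ ≤ 1) :
    ∑ e, κ ^ 3 / m * pairP d e ≤ 1 := by
  rw [← Finset.mul_sum]
  calc κ ^ 3 / m * ∑ e, pairP d e ≤ κ ^ 3 / m * m := by
        gcongr
        exact sum_pairP_le hm0 hm
    _ = κ ^ 3 := div_mul_cancel₀ _ (by exact_mod_cast hm0)
    _ ≤ 1 := pow_le_one₀ zero_le h1

theorem dominatedUpTo_poisSet (hK : NbhdBound d K) (hm : ∑ v, d v = 2 * m) (h0 : 0 < κ)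
    (h1 : κ < 1) (hKm : K ≤ (1 - κ : ℝ) ^ 2 * m) (hne : (edgeFamily d).Nonempty)
    (hq : ∑ e, κ ^ 3 / m * pairP d e ≤ 1) {D : ℝ} (hD0 : 0 ≤ D) (hD : ∀ v, D ≤ d v) :
    DominatedUpTo (ENNReal.ofReal (m * Fintype.card V * Real.exp (-(klFun κ * (1 - κ) * D)) +
        Real.exp ((1 - κ) * (1 - κ * (1 - κ) * m))))
      (poisSet (κ ^ 3 * m) (samplePMF (fun e => κ ^ 3 / m * pairP d e) hq))
      (unifPMF (edgeFamily d)) := by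
  have hT : (⌊(κ * m : NNReal)⌋₊ : ℝ) ≤ κ * m := by
    exact_mod_cast Nat.floor_le (zero_le : 0 ≤ κ * m)
  have hTm : ⌊(κ * m : NNReal)⌋₊ ≤ m := by
    refine Nat.floor_le_of_le ?_
    exact mul_le_of_le_one_left zero_le h1.le
  set T := ⌊(κ * m : NNReal)⌋₊
  have habove : above (edgeFamily d) ∅ = edgeFamily d := by simp [above]
  refine DominatedUpTo.mono (DominatedUpTo.bind_of_mem (s := {N | N ≤ T}) (b :=
    ENNReal.ofReal (degreePotential d m T κ ∅)) fun N hN => ?_) ?_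
  · rw [← habove]
    refine dominatedUpTo_sampleSet_unifPMF (fun G => card_of_mem_edgeFamily hm) hTm
      (B := fun H => ENNReal.ofReal (degreePotential d m T κ H)) (fun H hH hHT => ?_)
      (by rwa [habove]) (by simpa using hN) subset_rfl
    rcases isBalanced_or_one_le_degreePotential (d := d) hTm h0 h1.le hHT with hgood | hbad
    · refine Or.inr ⟨fun f hf => ?_,
        sum_nextEdge_mul_ofReal_degreePotential_le hm hH hTm h1.le hHT⟩
      have hHT' : (H.card : ℝ) ≤ κ * m := le_trans (by exact_mod_cast hHT.le) hT
      have hKH : K ≤ (1 - κ : ℝ) * (m - H.card : ℕ) := by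
        rw [Nat.cast_sub (hHT.le.trans hTm)]
        exact hKm.trans (by nlinarith [show (κ : ℝ) < 1 from h1])
      rw [samplePMF_some]
      exact_mod_cast hgood.pairP_le_nextEdge h1.le hK hm (hHT.trans_le hTm) hKH hH hf
    · exact Or.inl (ENNReal.one_le_ofReal.2 hbad)
  · rw [ENNReal.ofReal_add (by positivity) (by positivity)]
    refine add_le_add
      (ENNReal.ofReal_le_ofReal (degreePotential_empty_le hT hTm h0 h1.le hD0 hD)) ?_
    have hcompl : {N : ℕ | N ≤ T}ᶜ = {N | T < N} := by
      ext N
      simp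
    rw [hcompl]
    refine (poisPMF_tail_le _ (one_le_inv₀ h0 |>.2 h1.le) T).trans (ENNReal.ofReal_le_ofReal ?_)
    have hfloor : (κ * m : ℝ) ≤ T + 1 := by exact_mod_cast (Nat.lt_floor_add_one (κ * m)).le
    exact_mod_cast exp_div_pow_le h0 h1.le hfloor

end Domination

section Graphs

theorem measure_ext_Iic {α : Type*} [Finite α] [PartialOrder α] [MeasurableSpace α]
    [MeasurableSingletonClass α] {μ ν : Measure α} [IsFiniteMeasure ν]
    (h : ∀ a, μ (Set.Iic a) = ν (Set.Iic a)) : μ = ν := by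
  refine Measure.ext_of_singleton fun a => ?_
  induction a using WellFoundedLT.induction with
  | ind a ih =>
    have hmeas : MeasurableSet (Set.Iio a) := (Set.toFinite _).measurableSet
    have hsplit (ρ : Measure α) : ρ (Set.Iic a) = ρ {a} + ρ (Set.Iio a) := by
      rw [← Set.Iio_insert, Set.insert_eq, measure_union (by simp) hmeas]
    have hIio : μ (Set.Iio a) = ν (Set.Iio a) := by
      classical
      have := Fintype.ofFinite α
      rw [← Set.coe_toFinset (Set.Iio a), ← sum_measure_singleton, ← sum_measure_singleton]
      exact Finset.sum_congr rfl fun b hb => ih b (by simpa using hb)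
    have ha := h a
    rw [hsplit, hsplit, hIio] at ha
    exact (ENNReal.add_left_inj (measure_ne_top ν _)).1 ha

theorem toMeasure_map_unifPMF {α β : Type*} [Inhabited α] [MeasurableSpace β] [Countable β]
    [MeasurableSingletonClass β] {s : Finset α} (hs : s.Nonempty) {f : α → β}
    (hf : Set.InjOn f s) : ((unifPMF s).map f).toMeasure = uniformOn (f '' s) := by
  classical
  refine Measure.ext_of_singleton fun b => ?_
  have himage : s.image f ∩ {b} = {a ∈ s | a ∈ f ⁻¹' {b}}.image f := by
    ext c
    simp only [Finset.mem_inter, Finset.mem_image, Finset.mem_singleton, Finset.mem_filter,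
      Set.mem_preimage, Set.mem_singleton_iff]
    grind
  rw [← Finset.coe_image, ← Finset.coe_singleton, uniformOn_apply_finset, himage,
    Finset.card_image_of_injOn hf,
    Finset.card_image_of_injOn (hf.mono (Finset.coe_subset.2 (Finset.filter_subset _ _))),
    unifPMF_of_nonempty hs, Finset.coe_singleton, PMF.toMeasure_apply_eq_toOuterMeasure,
    PMF.toOuterMeasure_map_apply, PMF.toOuterMeasure_uniformOfFinset_apply]

instance {V : Type*} [Countable V] : MeasurableSingletonClass (SimpleGraph V) where
  measurableSet_singleton G := by
    rw [← SimpleGraph.edgeSet_injective.preimage_image {G}, Set.image_singleton]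
    exact SimpleGraph.measurable_edgeSet (measurableSet_singleton _)

/-- The simple graph with the given edges; loops are discarded. -/
def toGraph {V : Type*} (S : Finset (Sym2 V)) : SimpleGraph V := SimpleGraph.fromEdgeSet S

theorem monotone_toGraph {V : Type*} : Monotone (toGraph (V := V)) := fun _ _ h =>
  SimpleGraph.fromEdgeSet_mono (Finset.coe_subset.2 h)

theorem edgeSet_toGraph {V : Type*} {S : Finset (Sym2 V)} (hS : ∀ e ∈ S, ¬ e.IsDiag) :
    (toGraph S).edgeSet = S := by
  rw [toGraph, SimpleGraph.edgeSet_fromEdgeSet]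
  exact sdiff_eq_left.2 (Set.disjoint_left.2 hS)

theorem ncard_neighborSet_toGraph {V : Type*} [DecidableEq V] [Finite V] {S : Finset (Sym2 V)}
    (hS : ∀ e ∈ S, ¬ e.IsDiag) (v : V) : ((toGraph S).neighborSet v).ncard = edgeDeg S v := by
  have := Fintype.ofFinite V
  rw [← card_nbrs, ← Set.ncard_coe_finset]
  congr 1
  ext a
  rw [SimpleGraph.mem_neighborSet, ← SimpleGraph.mem_edgeSet, edgeSet_toGraph hS, Finset.mem_coe,
    Finset.mem_coe, mem_nbrs]

variable {n : ℕ} {d : Fin n → ℕ}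

theorem toGraph_image_edgeFamily (d : Fin n → ℕ) :
    toGraph '' (edgeFamily d : Set (Finset (Sym2 (Fin n)))) = realizations d := by
  classical
  ext G
  constructor
  · rintro ⟨S, hS, rfl⟩ v
    obtain ⟨hloop, hdeg⟩ := mem_edgeFamily.1 hS
    rw [ncard_neighborSet_toGraph hloop, hdeg]
  · intro hG
    have hloop (e) (he : e ∈ G.edgeFinset) : ¬ e.IsDiag := G.not_isDiag_of_mem_edgeFinset he
    have hgraph : toGraph G.edgeFinset = G := by
      rw [toGraph, SimpleGraph.coe_edgeFinset, SimpleGraph.fromEdgeSet_edgeSet]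
    refine ⟨G.edgeFinset, mem_edgeFamily.2 ⟨hloop, funext fun v => ?_⟩, hgraph⟩
    rw [← ncard_neighborSet_toGraph hloop, hgraph, hG v]

theorem injOn_toGraph (d : Fin n → ℕ) :
    Set.InjOn toGraph (edgeFamily d : Set (Finset (Sym2 (Fin n)))) := fun S hS T hT h => by
  rw [← Finset.coe_inj, ← edgeSet_toGraph (mem_edgeFamily.1 hS).1,
    ← edgeSet_toGraph (mem_edgeFamily.1 hT).1, h]

theorem toMeasure_map_toGraph_unifPMF (hne : (edgeFamily d).Nonempty) :
    ((unifPMF (edgeFamily d)).map toGraph).toMeasure = degreeModel d := by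
  rw [toMeasure_map_unifPMF hne (injOn_toGraph d), toGraph_image_edgeFamily, degreeModel]

theorem graphOfPairs_le_iff {ω : Pairs n → Prop} {G : SimpleGraph (Fin n)} :
    graphOfPairs ω ≤ G ↔ ∀ e : Pairs n, ω e → G.Adj e.1.1 e.1.2 := by
  refine ⟨fun h e he => h ?_, fun h j k hjk => ?_⟩
  · exact (SimpleGraph.fromRel_adj _ _ _).2 ⟨e.2.ne, Or.inl ⟨e.2, he⟩⟩
  · rcases ((SimpleGraph.fromRel_adj _ _ _).1 hjk).2 with ⟨_, he⟩ | ⟨_, he⟩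
    · exact h _ he
    · exact (h _ he).symm

theorem toGraph_le_iff {S : Finset (Sym2 (Fin n))} {G : SimpleGraph (Fin n)} :
    toGraph S ≤ G ↔ ∀ e : Pairs n, s(e.1.1, e.1.2) ∈ S → G.Adj e.1.1 e.1.2 := by
  refine ⟨fun h e he => h ?_, fun h j k hjk => ?_⟩
  · exact (SimpleGraph.fromEdgeSet_adj _).2 ⟨he, e.2.ne⟩
  · obtain ⟨hS, hne⟩ := (SimpleGraph.fromEdgeSet_adj _).1 hjk
    rcases hne.lt_or_gt with hlt | hlt
    · exact h ⟨(j, k), hlt⟩ hS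
    · exact (h ⟨(k, j), hlt⟩ (Sym2.eq_swap ▸ hS)).symm

theorem measurable_graphOfPairs : Measurable (graphOfPairs : (Pairs n → Prop) → _) :=
  measurable_of_countable _

instance (W : Matrix (Fin n) (Fin n) unitInterval) : IsProbabilityMeasure (edgeModel W) :=
  Measure.isProbabilityMeasure_map measurable_graphOfPairs.aemeasurable

open Classical in
theorem edgeModel_Iic (W : Matrix (Fin n) (Fin n) unitInterval) (G : SimpleGraph (Fin n)) :
    edgeModel W (Set.Iic G) =
      ∏ e : Pairs n with ¬ G.Adj e.1.1 e.1.2, ENNReal.ofReal (1 - W e.1.1 e.1.2) := by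
  rw [edgeModel, Measure.map_apply measurable_graphOfPairs (Set.toFinite _).measurableSet]
  have hpre : graphOfPairs ⁻¹' Set.Iic G = Set.univ.pi fun e : Pairs n =>
      if G.Adj e.1.1 e.1.2 then (Set.univ : Set Prop) else {False} := by
    ext ω
    rw [Set.mem_preimage, Set.mem_Iic, graphOfPairs_le_iff, Set.mem_univ_pi]
    refine forall_congr' fun e => ?_
    split_ifs with h <;> simp [h]
  rw [hpre, Measure.pi_pi, Finset.prod_filter]
  refine Finset.prod_congr rfl fun e _ => ?_
  by_cases h : G.Adj e.1.1 e.1.2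
  · rw [if_pos h, if_neg (not_not.2 h), measure_univ]
  · rw [if_neg h, if_pos h, bernoulliMeasure_apply _ (measurableSet_singleton _),
      if_neg (by simp), if_pos (by simp), ← ENNReal.ofReal_coe_nnreal]
    rfl

/-- The edge probabilities in a Poisson process of edges with intensities `w`: the edge `jk` shows
up at least once with probability `1 - exp (-w s(j, k))`. -/
def poissonMatrix (w : Sym2 (Fin n) → NNReal) : Matrix (Fin n) (Fin n) unitInterval :=
  Matrix.of fun j k => ⟨1 - Real.exp (-w s(j, k)),
    sub_nonneg.2 (Real.exp_le_one_iff.2 (neg_nonpos.2 (w s(j, k)).coe_nonneg)),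
    sub_le_self _ (Real.exp_nonneg _)⟩

theorem coe_poissonMatrix_apply (w : Sym2 (Fin n) → NNReal) (j k : Fin n) :
    (poissonMatrix w j k : ℝ) = 1 - Real.exp (-w s(j, k)) := rfl

theorem isSymm_poissonMatrix (w : Sym2 (Fin n) → NNReal) : (poissonMatrix w).IsSymm := by
  ext j k
  rw [Matrix.transpose_apply, coe_poissonMatrix_apply, coe_poissonMatrix_apply, Sym2.eq_swap]

theorem toMeasure_map_toGraph_poisSet (r : NNReal) (q : Sym2 (Fin n) → NNReal)
    (hq : ∑ e, q e ≤ 1) :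
    ((poisSet r (samplePMF q hq)).map toGraph).toMeasure = edgeModel (poissonMatrix (r • q)) := by
  classical
  refine measure_ext_Iic fun G => ?_
  set A : Finset (Sym2 (Fin n)) :=
    (Finset.univ.filter fun e : Pairs n => ¬ G.Adj e.1.1 e.1.2).image fun e => s(e.1.1, e.1.2)
  have hpre : toGraph ⁻¹' Set.Iic G = {S : Finset (Sym2 (Fin n)) | Disjoint S A} := by
    ext S
    rw [Set.mem_preimage, Set.mem_Iic, toGraph_le_iff, Set.mem_ofPred_eq, Finset.disjoint_right,
      Finset.forall_mem_image]
    simp only [Finset.mem_filter_univ, not_imp_not]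
  have hinj : Set.InjOn (fun e : Pairs n => s(e.1.1, e.1.2))
      (Finset.univ.filter fun e : Pairs n => ¬ G.Adj e.1.1 e.1.2) := by
    rintro ⟨⟨j, k⟩, h⟩ _ ⟨⟨j', k'⟩, h'⟩ _ heq
    rcases Sym2.eq_iff.1 heq with ⟨rfl, rfl⟩ | ⟨rfl, rfl⟩
    · rfl
    · exact absurd h (lt_asymm h')
  rw [edgeModel_Iic, PMF.toMeasure_apply_eq_toOuterMeasure, PMF.toOuterMeasure_map_apply, hpre,
    poisSet_void, Finset.prod_image hinj,
    ENNReal.ofReal_prod_of_nonneg fun _ _ => Real.exp_nonneg _]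
  refine Finset.prod_congr rfl fun e _ => ?_
  rw [coe_poissonMatrix_apply, sub_sub_cancel]
  rfl

end Graphs

section FiniteCoupling

open InformationTheory

variable {n m : ℕ} {d : Fin n → ℕ} {κ : NNReal}

theorem coe_pairP (d : Fin n → ℕ) (j k : Fin n) : (pairP d s(j, k) : ℝ) = P d j k := by
  rw [pairP_mk, P, Matrix.of_apply, norm1]
  split_ifs <;> push_cast <;> rfl

theorem minDeg_le (d : Fin n → ℕ) (j : Fin n) : minDeg d ≤ d j := ciInf_le (OrderBot.bddBelow _) j

theorem edgeFamily_nonempty_of_J_lt (hd : Antitone d) (heven : Even (norm1 d))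
    (hJ : 6 * J d < norm1 d) : (edgeFamily d).Nonempty :=
  edgeFamily_nonempty (nbhdBound_two_mul_J hd) heven (by rw [norm1] at hJ; omega)

/-- The bound for the probability that the coupling with thinning parameter `κ` fails, either
because the exposed graph gets unbalanced or because the Poisson process lasts too long. -/
def couplingError (κ : NNReal) (d : Fin n → ℕ) : ℝ :=
  norm1 d / 2 * n * Real.exp (-(klFun κ * (1 - κ) * minDeg d)) +
    Real.exp ((1 - κ) * (1 - κ * (1 - κ) * (norm1 d / 2)))

theorem exists_isCoupling_poissonMatrix (hd : Antitone d) (heven : Even (norm1 d))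
    (hpos : 0 < norm1 d) (hne : (edgeFamily d).Nonempty) (h0 : 0 < κ) (h1 : κ < 1)
    (hJ : (J d : ℝ) ≤ (1 - κ) ^ 2 / 4 * norm1 d) :
    ∃ γ : Measure (SimpleGraph (Fin n) × SimpleGraph (Fin n)),
      IsCoupling γ (edgeModel (poissonMatrix (κ ^ 6 • pairP d))) (degreeModel d) ∧
      1 - ENNReal.ofReal (couplingError κ d) ≤ γ {p | p.1 ≤ p.2} := by
  obtain ⟨m, hm⟩ := even_iff_exists_two_mul.1 heven
  have hm0 : m ≠ 0 := by omega
  have hnorm : (norm1 d : ℝ) / 2 = m := by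
    rw [hm, Nat.cast_mul, Nat.cast_two, mul_div_cancel_left₀ _ two_ne_zero]
  have hKm : (2 * J d : ℕ) ≤ (1 - κ : ℝ) ^ 2 * m := by
    rw [← hnorm]
    push_cast
    linarith
  have hq := sum_scaled_pairP_le_one hm0 hm h1.le
  have hdom := dominatedUpTo_poisSet (nbhdBound_two_mul_J hd) hm h0 h1 hKm hne hq
    (minDeg d).cast_nonneg fun j => Nat.cast_le.2 (minDeg_le d j)
  have hscale : (κ ^ 3 * m) • (fun e => κ ^ 3 / m * pairP d e) = κ ^ 6 • pairP d := by
    funext e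
    have hm0' : (m : NNReal) ≠ 0 := Nat.cast_ne_zero.2 hm0
    simp only [Pi.smul_apply, smul_eq_mul]
    field_simp
  obtain ⟨γ, hγ, hle⟩ := (hdom.map monotone_toGraph).exists_isCoupling
  rw [toMeasure_map_toGraph_poisSet, toMeasure_map_toGraph_unifPMF hne, hscale] at hγ
  rw [Fintype.card_fin, ← hnorm] at hle
  exact ⟨γ, hγ, hle⟩

end FiniteCoupling

section Asymptotics

open InformationTheory

theorem abs_one_sub_exp_neg_mul_sub_le {c p : ℝ} (hc0 : 0 ≤ c) (hc1 : c ≤ 1) (hp : 0 ≤ p) :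
    |(1 - Real.exp (-(c * p))) - (1 - Real.exp (-p))| ≤ (1 - c) * |1 - Real.exp (-p)| := by
  have hconv : Real.exp (-(c * p)) ≤ c * Real.exp (-p) + (1 - c) := by
    simpa [mul_comm] using convexOn_exp.2 (Set.mem_univ (-p)) (Set.mem_univ 0) hc0
      (sub_nonneg.2 hc1) (add_sub_cancel c 1)
  have hmono : Real.exp (-p) ≤ Real.exp (-(c * p)) :=
    Real.exp_le_exp.2 (neg_le_neg (mul_le_of_le_one_left hp hc1))
  have hexp : Real.exp (-p) ≤ 1 := Real.exp_le_one_iff.2 (neg_nonpos.2 hp)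
  rw [sub_sub_sub_cancel_left, abs_of_nonpos (sub_nonpos.2 hmono),
    abs_of_nonneg (sub_nonneg.2 hexp)]
  linarith

theorem exists_tendsto_eventually {Q : ℕ → ℕ → Prop} (h : ∀ k, ∀ᶠ n in atTop, Q k n) :
    ∃ u : ℕ → ℕ, Tendsto u atTop atTop ∧ ∀ᶠ n in atTop, Q (u n) n := by
  classical
  refine ⟨fun n => Nat.findGreatest (Q · n) n, tendsto_atTop.2 fun k => ?_, ?_⟩
  · filter_upwards [h k, eventually_ge_atTop k] with n hn hk using Nat.le_findGreatest hk hn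
  · filter_upwards [h 0] with n hn using Nat.findGreatest_spec (P := (Q · n)) n.zero_le hn

theorem exists_eventually_of_eventually_exists {α : ℕ → Type*} [∀ n, Nonempty (α n)]
    {Q : ∀ n, α n → Prop} (h : ∀ᶠ n in atTop, ∃ a, Q n a) :
    ∃ f : ∀ n, α n, ∀ᶠ n in atTop, Q n (f n) := by
  have hex (n : ℕ) : ∃ a : α n, (∃ a, Q n a) → Q n a := by
    by_cases hn : ∃ a, Q n a
    · exact hn.imp fun a ha _ => ha
    · exact ⟨Classical.arbitrary _, fun hn' => (hn hn').elim⟩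
  choose f hf using hex
  exact ⟨f, h.mono hf⟩

theorem le_norm1 {n : ℕ} {d : Fin n → ℕ} (hmin : 0 < minDeg d) : n ≤ norm1 d := by
  calc n = ∑ _j : Fin n, 1 := by simp
    _ ≤ norm1 d := Finset.sum_le_sum fun j _ => hmin.trans_le (minDeg_le d j)

theorem norm1_le_sq {n : ℕ} {d : Fin n → ℕ} (hne : (edgeFamily d).Nonempty) : norm1 d ≤ n ^ 2 := by
  obtain ⟨G, hG⟩ := hne
  calc norm1 d ≤ ∑ _j : Fin n, n := Finset.sum_le_sum fun j _ => by
        rw [← (mem_edgeFamily.1 hG).2, ← card_nbrs]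
        exact (Finset.card_le_univ _).trans_eq (Fintype.card_fin n)
    _ = n ^ 2 := by simp [sq]

variable {d : ∀ n : ℕ, Fin n → ℕ} {κ : NNReal}

theorem uniformlyAsymptotic_poissonMatrix {c : ℕ → NNReal} (hc1 : ∀ n, c n ≤ 1)
    (hc : Tendsto c atTop (𝓝 1)) (d : ∀ n : ℕ, Fin n → ℕ) :
    UniformlyAsymptotic (fun n => (poissonMatrix (c n • pairP (d n))).map fun x => (x : ℝ))
      (fun n => (P (d n)).map fun x => 1 - Real.exp (-x)) := by
  intro ε hε
  have hclose : ∀ᶠ n in atTop, 1 - ε < (c n : ℝ) :=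
    (NNReal.tendsto_coe.2 hc).eventually (lt_mem_nhds (by simpa using hε))
  filter_upwards [hclose] with n hn j k
  have hval : (poissonMatrix (c n • pairP (d n)) j k : ℝ) =
      1 - Real.exp (-(c n * P (d n) j k)) := by
    rw [coe_poissonMatrix_apply, Pi.smul_apply, smul_eq_mul, NNReal.coe_mul, coe_pairP]
  simp only [Matrix.map_apply, hval]
  refine (abs_one_sub_exp_neg_mul_sub_le (c n).coe_nonneg (hc1 n) ?_).trans ?_
  · rw [← coe_pairP]
    exact NNReal.coe_nonneg _
  · gcongr
    linarith

theorem eventually_mul_log_le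
    (hδ : (fun n : ℕ => Real.log n) =o[atTop] fun n => (minDeg (d n) : ℝ)) {C : ℝ} (hC : 0 < C) :
    ∀ᶠ n : ℕ in atTop, C * Real.log n ≤ minDeg (d n) := by
  filter_upwards [hδ.bound (inv_pos.2 hC)] with n hn
  rw [Real.norm_of_nonneg (Real.log_natCast_nonneg n), Real.norm_natCast] at hn
  rwa [← le_inv_mul_iff₀ hC]

theorem eventually_minDeg_pos
    (hδ : (fun n : ℕ => Real.log n) =o[atTop] fun n => (minDeg (d n) : ℝ)) :
    ∀ᶠ n in atTop, 0 < minDeg (d n) := by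
  filter_upwards [eventually_mul_log_le hδ one_pos, eventually_gt_atTop 1] with n hlog hn
  have hlog0 : 0 < Real.log n := Real.log_pos (by exact_mod_cast hn)
  rw [one_mul] at hlog
  exact Nat.cast_pos.1 (hlog0.trans_le hlog)

theorem eventually_edgeFamily_nonempty (hd : ∀ n, Antitone (d n)) (heven : ∀ n, Even (norm1 (d n)))
    (hJ : (fun n => (J (d n) : ℝ)) =o[atTop] fun n => (norm1 (d n) : ℝ))
    (hpos : ∀ᶠ n in atTop, 0 < norm1 (d n)) : ∀ᶠ n in atTop, (edgeFamily (d n)).Nonempty := by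
  filter_upwards [hJ.bound (c := 1 / 7) (by norm_num), hpos] with n hJn hn
  simp only [Real.norm_natCast] at hJn
  refine edgeFamily_nonempty_of_J_lt (hd n) (heven n) ?_
  have hn' : (0 : ℝ) < norm1 (d n) := Nat.cast_pos.2 hn
  have hlt : (6 * J (d n) : ℝ) < norm1 (d n) := by linarith
  exact_mod_cast hlt

theorem tendsto_sq_mul_exp_neg_minDeg
    (hδ : (fun n : ℕ => Real.log n) =o[atTop] fun n => (minDeg (d n) : ℝ)) {c : ℝ} (hc : 0 < c)
    {a : ℕ → ℝ} (ha0 : ∀ n, 0 ≤ a n) (ha : ∀ᶠ n : ℕ in atTop, a n ≤ n ^ 2) :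
    Tendsto (fun n : ℕ => a n * n * Real.exp (-(c * minDeg (d n)))) atTop (𝓝 0) := by
  refine squeeze_zero' (Eventually.of_forall fun n => ?_) ?_ tendsto_one_div_atTop_nhds_zero_nat
  · have := ha0 n
    positivity
  filter_upwards [ha, eventually_mul_log_le hδ (show 0 < 4 / c by positivity),
    eventually_gt_atTop 0] with n han hlog hn
  have hn0 : (0 : ℝ) < n := Nat.cast_pos.2 hn
  have hexp : Real.exp (-(c * minDeg (d n))) ≤ ((n : ℝ) ^ 4)⁻¹ := by
    rw [← Real.exp_log (pow_pos hn0 4), ← Real.exp_neg, Real.exp_le_exp, Real.log_pow,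
      neg_le_neg_iff, Nat.cast_ofNat]
    rwa [div_mul_eq_mul_div, div_le_iff₀' hc] at hlog
  calc a n * n * Real.exp (-(c * minDeg (d n))) ≤ n ^ 2 * n * ((n : ℝ) ^ 4)⁻¹ := by gcongr
    _ = 1 / n := by field_simp

theorem tendsto_couplingError
    (hδ : (fun n : ℕ => Real.log n) =o[atTop] fun n => (minDeg (d n) : ℝ))
    (hne : ∀ᶠ n in atTop, (edgeFamily (d n)).Nonempty) (h0 : 0 < κ) (h1 : κ < 1) :
    Tendsto (fun n => couplingError κ (d n)) atTop (𝓝 0) := by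
  have h0' : 0 < (κ : ℝ) := h0
  have h1' : 0 < 1 - (κ : ℝ) := sub_pos.2 h1
  have hnorm : Tendsto (fun n => (norm1 (d n) : ℝ)) atTop atTop :=
    tendsto_natCast_atTop_atTop.comp
      (tendsto_atTop_mono' atTop ((eventually_minDeg_pos hδ).mono fun _ => le_norm1) tendsto_id)
  rw [← add_zero (0 : ℝ)]
  refine Tendsto.add ?_ (Real.tendsto_exp_atBot.comp ?_)
  · refine tendsto_sq_mul_exp_neg_minDeg hδ (mul_pos (klFun_pos_of_lt_one h0'.le h1) h1')
      (fun n => by positivity) (hne.mono fun n hn => ?_)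
    have hle : (norm1 (d n) : ℝ) ≤ n ^ 2 := by exact_mod_cast norm1_le_sq hn
    linarith [(norm1 (d n)).cast_nonneg (α := ℝ)]
  · refine Tendsto.const_mul_atBot h1' ?_
    refine tendsto_const_nhds.add_atBot (tendsto_neg_atTop_atBot.comp ?_)
    exact (hnorm.atTop_div_const two_pos).const_mul_atTop (mul_pos h0' h1')

theorem eventually_exists_isCoupling (hd : ∀ n, Antitone (d n)) (heven : ∀ n, Even (norm1 (d n)))
    (hJ : (fun n => (J (d n) : ℝ)) =o[atTop] fun n => (norm1 (d n) : ℝ))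
    (hδ : (fun n : ℕ => Real.log n) =o[atTop] fun n => (minDeg (d n) : ℝ))
    (h0 : 0 < κ) (h1 : κ < 1) {b : ENNReal} (hb : 0 < b) :
    ∀ᶠ n in atTop, ∃ γ : Measure (SimpleGraph (Fin n) × SimpleGraph (Fin n)),
      IsCoupling γ (edgeModel (poissonMatrix (κ ^ 6 • pairP (d n)))) (degreeModel (d n)) ∧
      1 - b ≤ γ {p | p.1 ≤ p.2} := by
  have hpos : ∀ᶠ n in atTop, 0 < norm1 (d n) := by
    filter_upwards [eventually_minDeg_pos hδ, eventually_gt_atTop 0] with n hmin hn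
      using hn.trans_le (le_norm1 hmin)
  have hne := eventually_edgeFamily_nonempty hd heven hJ hpos
  have herror : ∀ᶠ n in atTop, ENNReal.ofReal (couplingError κ (d n)) < b :=
    (ENNReal.tendsto_ofReal (tendsto_couplingError hδ hne h0 h1)).eventually
      (gt_mem_nhds (by simpa using hb))
  have h1' : 0 < 1 - (κ : ℝ) := sub_pos.2 h1
  filter_upwards [hpos, hne, herror, hJ.bound (c := (1 - κ) ^ 2 / 4) (by positivity)]
    with n hn hne herr hJn
  simp only [Real.norm_natCast] at hJn
  obtain ⟨γ, hγ, hle⟩ := exists_isCoupling_poissonMatrix (hd n) (heven n) hn hne h0 h1 hJn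
  exact ⟨γ, hγ, (tsub_le_tsub_left herr.le 1).trans hle⟩

end Asymptotics

end DegSeq

end

theorem mainTheorem1 (d : ∀ n : ℕ, Fin n → ℕ)
    (hd : ∀ n, Antitone (d n))
    (heven : ∀ n, Even (DegSeq.norm1 (d n)))
    (hJ : (fun n => (DegSeq.J (d n) : ℝ)) =o[atTop] fun n => (DegSeq.norm1 (d n) : ℝ))
    (hδ : (fun n : ℕ => Real.log n) =o[atTop] fun n => (DegSeq.minDeg (d n) : ℝ)) :
    ∃ W : ∀ n : ℕ, Matrix (Fin n) (Fin n) unitInterval,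
      (∀ n, (W n).IsSymm) ∧
      DegSeq.UniformlyAsymptotic (fun n => (W n).map fun x => (x : ℝ))
        (fun n => (DegSeq.P (d n)).map fun x => 1 - Real.exp (-x)) ∧
      ∃ γ : ∀ n : ℕ, Measure (SimpleGraph (Fin n) × SimpleGraph (Fin n)),
        (∀ᶠ n in atTop,
          DegSeq.IsCoupling (γ n) (DegSeq.edgeModel (W n)) (DegSeq.degreeModel (d n))) ∧
        Tendsto (fun n => γ n {p | p.1 ≤ p.2}) atTop (𝓝 1) := by
  obtain ⟨κ, -, hκ, hκ1⟩ := exists_seq_strictMono_tendsto' (zero_lt_one : (0 : NNReal) < 1)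
  obtain ⟨u, hu, hcoupling⟩ := DegSeq.exists_tendsto_eventually fun k =>
    DegSeq.eventually_exists_isCoupling hd heven hJ hδ (hκ k).1 (hκ k).2 (b := (k : ENNReal)⁻¹)
      (by simp)
  obtain ⟨γ, hγ⟩ := DegSeq.exists_eventually_of_eventually_exists hcoupling
  have hc : Tendsto (fun n => κ (u n) ^ 6) atTop (𝓝 1) := by
    simpa using (hκ1.comp hu).pow 6
  have hlower : Tendsto (fun n => 1 - (u n : ENNReal)⁻¹) atTop (𝓝 1) := by
    simpa using ENNReal.Tendsto.sub tendsto_const_nhds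
      (ENNReal.tendsto_inv_nat_nhds_zero.comp hu) (Or.inl ENNReal.one_ne_top)
  refine ⟨fun n => DegSeq.poissonMatrix (κ (u n) ^ 6 • DegSeq.pairP (d n)),
    fun n => DegSeq.isSymm_poissonMatrix _,
    DegSeq.uniformlyAsymptotic_poissonMatrix (fun n => pow_le_one₀ zero_le (hκ _).2.le) hc d,
    γ, hγ.mono fun n hn => hn.1, ?_⟩
  refine tendsto_of_tendsto_of_tendsto_of_le_of_le' hlower tendsto_const_nhds
    (hγ.mono fun n hn => hn.2) (hγ.mono fun n hn => ?_)
  have := hn.1.isProbabilityMeasure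
  exact prob_le_one
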